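/- **Trees and the Thompson group.** Trees are finite rooted planar bifurcating trees; the leaves of a tree with $n$ leaves are numbered $0,\dots,n-1$ from left to right, and the leaf $i$ of $T$ is identified with the finite word $w_i(T)$ in $0$ (left), $1$ (right) that leads to it from the root. For trees $T_+,T_-$ with the same number $n$ of leaves let $g(T_+,T_-)$ be the bijection of the Cantor space $\{0,1\}^{\mathbb N}$ with $w_i(T_-)\,y\mapsto w_i(T_+)\,y$ for all $i$ and all infinite words $y$. These bijections form the Thompson group $F$; one has $g(T_+,T)\,g(T,T_-)=g(T_+,T_-)$, and $g(T_+,T_-)$ does not change when a pair of opposing carets is added. **The graph $\Gamma$ and the link $L$.** Draw $T_+$ in the upper half plane with its leaves on the real axis and draw $T_-$, reflected, in the lower half plane with the same leaves. The signed plane graph $\Gamma(T_+,T_-)$ has $n$ vertices $v_0,\dots,v_{n-1}$ on the axis, $v_i$ immediately to the left of the leaf $i$. For each caret of $T_+$ (respectively $T_-$) it has one positive edge in the upper (respectively one negative edge in the lower) half plane, which crosses the left edge of that caret and no other edge of the trees: it joins $v_a$ to $v_m$, where $a$ is the first leaf below the caret and $m$ is the first leaf below the right edge of the caret. The link $L(T_+,T_-)$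 is the link whose diagram is the medial graph of $\Gamma(T_+,T_-)$, with a crossing in the middle of each edge, resolved according to the sign of the edge (a vertex without edges gives a circle without crossings); $c(L)$ is its number of components. **Theorem.** The integer $$c(g)=c(L(T_+,T_-))-n,\qquad g=g(T_+,T_-),$$ where $n$ is the number of leaves of $T_+$ and $T_-$, depends only on $g\in F$ and not on the pair of trees that represents it. Let $\vec F\le F$ be the Jones–Thompson group, that is, the subgroup of all $g=g(T_+,T_-)$ for which $\Gamma(T_+,T_-)$ is bipartite. Then for every nonzero integer $k$ the function $g\mapsto k^{c(g)}$ is of positive type on $\vec F$: for all $r$ and all $g_1,\dots,g_r\in\vec F$ the matrix $\bigl(k^{c(g_ig_j^{-1})}\bigr)_{i,j=1}^r$ is positive semidefinite. -/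

import Mathlib

/-! Rooted bifurcating trees are `BinaryTree Unit`: `nil` is a single leaf and `node () l r` is a
caret with the tree `l` below its left edge and `r` below its right edge.  The leaves (and, in the
same way, the vertices of the graph `Γ`) are numbered `0, …, n - 1` from left to right. -/

noncomputable section

namespace JonesThompson

open BinaryTree

/-! ### The Thompson group -/

/-- The Cantor space of infinite binary words (binary expansions of points of `[0,1]`). -/
abbrev Cantor : Type := ℕ → Bool

/-- First letter and remaining word. -/
def headTail : Cantor ≃ Bool × Cantor where
  toFun x := (x 0, fun i => x (i + 1))
  invFun p := fun i => Nat.casesOn i p.1 p.2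
  left_inv x := by funext i; cases i <;> rfl
  right_inv p := rfl

/-- A tree cuts the Cantor space into the cylinders of its leaves: a word `x` is read along the
tree from the root (`false` = go left, `true` = go right) until a leaf is reached; the result is
the number of this leaf, together with the unread part of `x`. -/
def split : (T : BinaryTree Unit) → Cantor ≃ Fin T.numLeaves × Cantor
  | nil => (Equiv.uniqueProd Cantor (Fin 1)).symm
  | node _ l r =>
      headTail.trans <| (Equiv.boolProdEquivSum Cantor).trans <|
        (Equiv.sumCongr (split l) (split r)).trans <|
          (Equiv.sumProdDistrib _ _ _).symm.trans <|
            Equiv.prodCongr finSumFinEquiv (Equiv.refl Cantor)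

/-- The element `g(S, T)`, for trees `S = T₊` and `T = T₋` with the same number of leaves: it
replaces the prefix given by the `i`-th leaf of `T` by the one given by the `i`-th leaf of `S`. -/
def ofTrees (S T : BinaryTree Unit) (h : S.numLeaves = T.numLeaves) : Equiv.Perm Cantor :=
  (split T).trans <| (Equiv.prodCongr (finCongr h.symm) (Equiv.refl Cantor)).trans (split S).symm

/-- Number of the leaf reached by `x`. -/
def leafOf (T : BinaryTree Unit) (x : Cantor) : ℕ := (split T x).1

/-- Unread part of `x`. -/
def tailOf (T : BinaryTree Unit) (x : Cantor) : Cantor := (split T x).2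

theorem leafOf_lt (T : BinaryTree Unit) (x : Cantor) : leafOf T x < T.numLeaves :=
  (split T x).1.isLt

theorem eq_of_leaf_tail {T : BinaryTree Unit} {x y : Cantor} (h : leafOf T x = leafOf T y)
    (h' : tailOf T x = tailOf T y) : x = y :=
  (split T).injective (Prod.ext (Fin.ext h) h')

theorem exists_leafOf (T : BinaryTree Unit) {v : ℕ} (hv : v < T.numLeaves) :
    ∃ x, leafOf T x = v :=
  ⟨(split T).symm (⟨v, hv⟩, fun _ => false), by simp [leafOf]⟩

theorem leafOf_ofTrees (S T : BinaryTree Unit) (h : S.numLeaves = T.numLeaves) (x : Cantor) :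
    leafOf S (ofTrees S T h x) = leafOf T x := by
  simp [leafOf, ofTrees]

theorem tailOf_ofTrees (S T : BinaryTree Unit) (h : S.numLeaves = T.numLeaves) (x : Cantor) :
    tailOf S (ofTrees S T h x) = tailOf T x := by
  simp [tailOf, ofTrees]

theorem ofTrees_mul (A B C : BinaryTree Unit) (h : A.numLeaves = B.numLeaves)
    (h' : B.numLeaves = C.numLeaves) :
    ofTrees A B h * ofTrees B C h' = ofTrees A C (h.trans h') := by
  ext1 x
  apply eq_of_leaf_tail (T := A)
  · simp [leafOf_ofTrees]
  · simp [tailOf_ofTrees]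

theorem ofTrees_self (A : BinaryTree Unit) : ofTrees A A rfl = 1 := by
  ext1 x
  apply eq_of_leaf_tail (T := A)
  · simp [leafOf_ofTrees]
  · simp [tailOf_ofTrees]

theorem ofTrees_inv (A B : BinaryTree Unit) (h : A.numLeaves = B.numLeaves) :
    (ofTrees A B h)⁻¹ = ofTrees B A h.symm := by
  rw [inv_eq_iff_mul_eq_one, ofTrees_mul, ofTrees_self]

theorem leafOf_nil (x : Cantor) : leafOf nil x = 0 := by
  simp [leafOf]

theorem tailOf_nil (x : Cantor) : tailOf nil x = x := by
  rfl

/-- The recursive step of `split`. -/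
theorem split_node (u : Unit) (l r : BinaryTree Unit) (x : Cantor) :
    split (node u l r) x = Equiv.prodCongr finSumFinEquiv (Equiv.refl Cantor)
      ((Equiv.sumProdDistrib _ _ _).symm (Equiv.sumCongr (split l) (split r)
        (Equiv.boolProdEquivSum Cantor (x 0, fun i => x (i + 1))))) := rfl

theorem leafOf_node (u : Unit) (l r : BinaryTree Unit) (x : Cantor) :
    leafOf (node u l r) x = if x 0 then l.numLeaves + leafOf r (fun i => x (i + 1))
      else leafOf l (fun i => x (i + 1)) := by
  rw [leafOf, split_node]
  cases h : x 0 <;> rfl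

theorem tailOf_node (u : Unit) (l r : BinaryTree Unit) (x : Cantor) :
    tailOf (node u l r) x = if x 0 then tailOf r (fun i => x (i + 1))
      else tailOf l (fun i => x (i + 1)) := by
  rw [tailOf, split_node]
  cases h : x 0 <;> rfl

/-- The tree obtained by attaching the tree `s i` to the `i`-th leaf. -/
def graft : BinaryTree Unit → (ℕ → BinaryTree Unit) → BinaryTree Unit
  | nil, s => s 0
  | node u l r, s => node u (graft l s) (graft r fun i => s (l.numLeaves + i))

theorem graft_nil (T : BinaryTree Unit) : graft T (fun _ => nil) = T := by
  induction T with
  | nil => rfl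
  | node u l r hl hr => simp [graft, hl, hr]

theorem graft_congr (T : BinaryTree Unit) (s t : ℕ → BinaryTree Unit)
    (h : ∀ i < T.numLeaves, s i = t i) : graft T s = graft T t := by
  induction T generalizing s t with
  | nil => exact h 0 (by simp)
  | node u l r hl hr =>
    simp only [numLeaves] at h
    simp only [graft]
    rw [hl s t fun i hi => h i (by omega),
      hr (fun i => s (l.numLeaves + i)) (fun i => t (l.numLeaves + i))
        fun i hi => h _ (by omega)]

theorem exists_graft_eq (B C : BinaryTree Unit) : ∃ s t, graft B s = graft C t := by
  induction B generalizing C with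
  | nil => exact ⟨fun _ => C, fun _ => nil, by simp [graft, graft_nil]⟩
  | node u l r hl hr =>
    cases C with
    | nil => exact ⟨fun _ => nil, fun _ => node u l r, by simp [graft, graft_nil]⟩
    | node u' l' r' =>
      obtain ⟨s₁, t₁, h₁⟩ := hl l'
      obtain ⟨s₂, t₂, h₂⟩ := hr r'
      refine ⟨fun i => if i < l.numLeaves then s₁ i else s₂ (i - l.numLeaves),
        fun i => if i < l'.numLeaves then t₁ i else t₂ (i - l'.numLeaves), ?_⟩
      simp only [graft]
      rw [graft_congr l _ s₁ (by intro i hi; simp [hi]),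
        graft_congr l' _ t₁ (by intro i hi; simp [hi]),
        graft_congr r _ s₂ (by intro i hi; simp),
        graft_congr r' _ t₂ (by intro i hi; simp), h₁, h₂]

theorem numLeaves_graft (T : BinaryTree Unit) (s : ℕ → BinaryTree Unit) :
    (graft T s).numLeaves = ∑ i ∈ Finset.range T.numLeaves, (s i).numLeaves := by
  induction T generalizing s with
  | nil => simp [graft]
  | node u l r hl hr => simp [graft, hl, hr, Finset.sum_range_add]

theorem leafOf_graft (T : BinaryTree Unit) (s : ℕ → BinaryTree Unit) (x : Cantor) :
    leafOf (graft T s) x = (∑ i ∈ Finset.range (leafOf T x), (s i).numLeaves) +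
      leafOf (s (leafOf T x)) (tailOf T x) := by
  induction T generalizing s x with
  | nil => simp [graft, leafOf_nil, tailOf_nil]
  | node u l r hl hr =>
    simp only [graft, leafOf_node, tailOf_node]
    cases h : x 0
    · simp [hl]
    · simp [hr, numLeaves_graft, Finset.sum_range_add, add_assoc]

theorem tailOf_graft (T : BinaryTree Unit) (s : ℕ → BinaryTree Unit) (x : Cantor) :
    tailOf (graft T s) x = tailOf (s (leafOf T x)) (tailOf T x) := by
  induction T generalizing s x with
  | nil => simp [graft, leafOf_nil, tailOf_nil]
  | node u l r hl hr =>
    simp only [graft, leafOf_node, tailOf_node]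
    cases h : x 0
    · simp [hl]
    · simp [hr]

theorem ofTrees_graft (S T : BinaryTree Unit) (h : S.numLeaves = T.numLeaves)
    (s : ℕ → BinaryTree Unit) :
    ofTrees (graft S s) (graft T s) (by rw [numLeaves_graft, numLeaves_graft, h]) =
      ofTrees S T h := by
  ext1 x
  apply eq_of_leaf_tail (T := graft S s)
  · rw [leafOf_ofTrees, leafOf_graft, leafOf_graft, leafOf_ofTrees, tailOf_ofTrees]
  · rw [tailOf_ofTrees, tailOf_graft, tailOf_graft, leafOf_ofTrees, tailOf_ofTrees]

/-- Any two elements have representatives `g(A, B)` and `g(B, D)`. -/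
theorem exists_common (S T S' T' : BinaryTree Unit) (h : S.numLeaves = T.numLeaves)
    (h' : S'.numLeaves = T'.numLeaves) :
    ∃ (s t : ℕ → BinaryTree Unit) (e : (graft S s).numLeaves = (graft T' t).numLeaves),
      graft T s = graft S' t ∧
        ofTrees S T h * ofTrees S' T' h' = ofTrees (graft S s) (graft T' t) e := by
  obtain ⟨s, t, hst⟩ := exists_graft_eq T S'
  have e₁ : (graft S s).numLeaves = (graft S' t).numLeaves := by
    rw [← hst, numLeaves_graft, numLeaves_graft, h]
  have e₂ : (graft S' t).numLeaves = (graft T' t).numLeaves := by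
    rw [numLeaves_graft, numLeaves_graft, h']
  refine ⟨s, t, e₁.trans e₂, hst, ?_⟩
  rw [← ofTrees_mul _ _ _ e₁ e₂, ← ofTrees_graft S T h s, ← ofTrees_graft S' T' h' t]
  congr 1
  simp only [hst]

/-- The Thompson group `F`: the group of all `g(S, T)` for pairs of trees `(S, T)` with the same
number of leaves. It satisfies `g(A, B) g(B, C) = g(A, C)`, and `g(S, T)` does not change when
opposing carets are added to (or cancelled from) `S` and `T`. -/
def ThompsonF : Subgroup (Equiv.Perm Cantor) where
  carrier := {g | ∃ S T h, g = ofTrees S T h}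
  mul_mem' := by
    rintro _ _ ⟨S, T, h, rfl⟩ ⟨S', T', h', rfl⟩
    obtain ⟨s, t, e, -, he⟩ := exists_common S T S' T' h h'
    exact ⟨_, _, e, he⟩
  one_mem' := ⟨nil, nil, rfl, (ofTrees_self nil).symm⟩
  inv_mem' := by
    rintro _ ⟨S, T, h, rfl⟩
    exact ⟨T, S, h.symm, ofTrees_inv S T h⟩

/-- `g(S, T)` as an element of the Thompson group. -/
def element (S T : BinaryTree Unit) (h : S.numLeaves = T.numLeaves) : ThompsonF :=
  ⟨ofTrees S T h, S, T, h, rfl⟩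

/-! ### Signed plane graphs and their medial link diagrams -/

/-- A signed graph (multiple edges allowed) with vertices `0, …, n - 1`, drawn in the oriented
plane. The drawing is recorded by its rotation system: an edge `e` has the two half-edges
`(e, false)` and `(e, true)`, and `rot v` lists the half-edges at the vertex `v` in
counterclockwise order. `positive e` says that the sign of `e` is `+`. -/
structure SignedPlaneGraph (n : ℕ) (Edge : Type) where
  positive : Edge → Prop
  rot : Fin n → List (Edge × Bool)
  nodup : ∀ v, (rot v).Nodup
  existsUnique : ∀ d, ∃! v, d ∈ rot v

namespace SignedPlaneGraph

/-- The underlying simple graph: distinct vertices are adjacent if they are joined by an edge. -/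
def toSimpleGraph {n : ℕ} {Edge : Type} (G : SignedPlaneGraph n Edge) :
    SimpleGraph (Fin n) :=
  SimpleGraph.fromRel fun v w => ∃ e, (e, false) ∈ G.rot v ∧ (e, true) ∈ G.rot w

open scoped Classical in
/-- The permutation sending a half-edge to the next one counterclockwise around its vertex: the
product over the vertices `v` of the (disjoint) cycles `(d₁ d₂ … dᵣ)`, where
`rot v = [d₁, …, dᵣ]`. -/
def rotPerm {n : ℕ} {Edge : Type} (G : SignedPlaneGraph n Edge) :
    Equiv.Perm (Edge × Bool) :=
  ((List.finRange n).map fun v => (G.rot v).formPerm).prod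

theorem finite_edge {n : ℕ} {Edge : Type} (G : SignedPlaneGraph n Edge) :
    Finite (Edge × Bool) := by
  classical
  have : (Set.univ : Set (Edge × Bool)) ⊆ ⋃ v, {d | d ∈ G.rot v} := by
    intro d _
    obtain ⟨v, hv, -⟩ := G.existsUnique d
    exact Set.mem_iUnion.2 ⟨v, hv⟩
  exact Set.finite_univ_iff.1 ((Set.finite_iUnion fun v => (G.rot v).finite_toSet).subset this)

end SignedPlaneGraph

/-- A link diagram, as a planar diagram code. Cutting the diagram at its crossings leaves
finitely many arcs; some of them may be circles without crossings. The four ends of arcs at a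
crossing `x` are `ends x 0, …, ends x 3` in counterclockwise order, where `ends x 0` and
`ends x 2` belong to the strand that passes under and `ends x 1` and `ends x 3` to the one that
passes over. An arc has two ends at crossings, or none if it is a circle. -/
structure LinkDiagram (Arc Crossing : Type) where
  finite_arc : Finite Arc
  finite_crossing : Finite Crossing
  ends : Crossing → Fin 4 → Arc
  card_ends : ∀ a, {p : Crossing × Fin 4 | ends p.1 p.2 = a}.encard = 2 ∨
    {p : Crossing × Fin 4 | ends p.1 p.2 = a} = ∅

/-- Two arcs continue each other straight through a crossing. -/
def LinkDiagram.Continues {Arc Crossing : Type} (L : LinkDiagram Arc Crossing) (a b : Arc) : Prop :=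
  ∃ x, (L.ends x 0 = a ∧ L.ends x 2 = b) ∨ (L.ends x 1 = a ∧ L.ends x 3 = b)

/-- The number `c(L)` of components of the link: the number of classes of arcs under the
equivalence relation generated by `Continues`. -/
def LinkDiagram.numComponents {Arc Crossing : Type} (L : LinkDiagram Arc Crossing) : ℕ :=
  Nat.card (Quot L.Continues)

open scoped Classical in
/-- The link diagram whose shadow is the medial graph of a signed plane graph, with a crossing in
the middle of each edge. Its arcs are the corners of the graph: the corner called `d` lies between
the half-edge `d` and the next half-edge counterclockwise around the vertex of `d`, so the corner
before `d` is the one called `rotPerm⁻¹ d`; a vertex without edges is encircled by an arc without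
crossings. With `d = (e, false)` and `d' = (e, true)`, the corners around the middle of the edge
`e` are, counterclockwise: after `d`, before `d`, after `d'`, before `d'`. The strand joining
the corner after `d` to the one after `d'` passes under if `e` is positive and over otherwise. -/
def SignedPlaneGraph.medial {n : ℕ} {Edge : Type} (G : SignedPlaneGraph n Edge) :
    LinkDiagram ((Edge × Bool) ⊕ {v : Fin n // G.rot v = []}) Edge where
  finite_arc := by
    have := G.finite_edge
    infer_instance
  finite_crossing := by
    have := G.finite_edge
    exact Finite.of_injective (fun e : Edge => (e, true)) fun a b h => (Prod.ext_iff.1 h).1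
  ends e :=
    if G.positive e then
      ![.inl (e, false), .inl (G.rotPerm⁻¹ (e, false)),
        .inl (e, true), .inl (G.rotPerm⁻¹ (e, true))]
    else
      ![.inl (G.rotPerm⁻¹ (e, false)), .inl (e, true),
        .inl (G.rotPerm⁻¹ (e, true)), .inl (e, false)]
  card_ends := by
    rintro (d | v)
    · left
      obtain ⟨⟨e, b⟩, hd⟩ : ∃ d' : Edge × Bool, d' = d := ⟨d, rfl⟩
      obtain ⟨⟨e', b'⟩, hd'⟩ : ∃ d' : Edge × Bool, d' = G.rotPerm d := ⟨_, rfl⟩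
      have key : ∀ c, G.rotPerm⁻¹ c = d ↔ c = (e', b') := by
        intro c; rw [Equiv.Perm.inv_eq_iff_eq, hd']
      let i : Fin 4 := if G.positive e then (if b then 2 else 0) else (if b then 1 else 3)
      let j : Fin 4 := if G.positive e' then (if b' then 3 else 1) else (if b' then 2 else 0)
      have hset : {p : Edge × Fin 4 | (if G.positive p.1 then
          ![Sum.inl (p.1, false), Sum.inl (G.rotPerm⁻¹ (p.1, false)),
            Sum.inl (p.1, true), Sum.inl (G.rotPerm⁻¹ (p.1, true))]
        else
          ![Sum.inl (G.rotPerm⁻¹ (p.1, false)), Sum.inl (p.1, true),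
            Sum.inl (G.rotPerm⁻¹ (p.1, true)), Sum.inl (p.1, false)] :
            Fin 4 → (Edge × Bool) ⊕ {v : Fin n // G.rot v = []}) p.2 = Sum.inl d} =
          {(e, i), (e', j)} := by
        ext ⟨f, k⟩
        simp only [Set.mem_ofPred_eq, Set.mem_insert_iff, Set.mem_singleton_iff, Prod.mk.injEq, i, j]
        by_cases hf : G.positive f
        · rw [if_pos hf]
          fin_cases k <;> simp <;> grind
        · rw [if_neg hf]
          fin_cases k <;> simp <;> grind
      rw [hset]
      apply Set.encard_pair
      simp only [ne_eq, Prod.mk.injEq, not_and, i, j]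
      rintro rfl
      split_ifs <;> decide
    · right
      ext ⟨f, k⟩
      by_cases hf : G.positive f <;> simp [hf] <;> fin_cases k <;> simp

/-! ### The graph `Γ` and the link of a pair of trees -/

/-- The carets of a tree: the top caret, and those of its left and of its right subtree. -/
inductive Caret : BinaryTree Unit → Type
  | top (u : Unit) (l r : BinaryTree Unit) : Caret (node u l r)
  | left (u : Unit) {l : BinaryTree Unit} (r : BinaryTree Unit) (c : Caret l) : Caret (node u l r)
  | right (u : Unit) (l : BinaryTree Unit) {r : BinaryTree Unit} (c : Caret r) : Caret (node u l r)

/-- Put `T` in the upper half plane, with its leaves on the real axis, and place a vertex `v` on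
the axis immediately to the left of each leaf `v`. For each caret of `T`, an edge crosses the left
edge of the caret: it joins the vertex just left of all leaves below the caret to the vertex just
left of the leaves below its right edge. `fan T v` lists the half-edges at `v` in counterclockwise
order from the positive to the negative real direction; `(c, false)` and `(c, true)` are the left
and the right half of the edge of the caret `c`. -/
def fan : (T : BinaryTree Unit) → ℕ → List (Caret T × Bool)
  | nil, _ => []
  | node u l r, v =>
      if v < l.numLeaves then
        (fan l v).map (Prod.map (Caret.left u r) id) ++
          (if v = 0 then [(Caret.top u l r, false)] else [])
      else
        (fan r (v - l.numLeaves)).map (Prod.map (Caret.right u l) id) ++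
          (if v = l.numLeaves then [(Caret.top u l r, true)] else [])

theorem nodup_fan (T : BinaryTree Unit) (v : ℕ) : (fan T v).Nodup := by
  induction T generalizing v with
  | nil => exact List.nodup_nil
  | node u l r hl hr =>
    have il : Function.Injective (Prod.map (Caret.left u (l := l) r) (id : Bool → Bool)) :=
      Function.Injective.prodMap (fun a b h => by simpa using h) Function.injective_id
    have ir : Function.Injective (Prod.map (Caret.right u l (r := r)) (id : Bool → Bool)) :=
      Function.Injective.prodMap (fun a b h => by simpa using h) Function.injective_id
    simp only [fan]
    split_ifs
    · refine List.Nodup.append ((hl v).map il) (List.nodup_singleton _) ?_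
      simp
    · simpa using (hl v).map il
    · refine List.Nodup.append ((hr _).map ir) (List.nodup_singleton _) ?_
      simp
    · simpa using (hr _).map ir

/-- The vertex of a half-edge. -/
def vertexOf : {T : BinaryTree Unit} → Caret T → Bool → ℕ
  | _, .top _ l _, b => if b then l.numLeaves else 0
  | _, .left _ _ c, b => vertexOf c b
  | _, .right _ l c, b => l.numLeaves + vertexOf c b

theorem vertexOf_lt {T : BinaryTree Unit} (c : Caret T) (b : Bool) :
    vertexOf c b < T.numLeaves := by
  induction c with
  | top u l r =>
    have h₁ := l.numLeaves_pos
    have h₂ := r.numLeaves_pos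
    cases b <;> simp [vertexOf, h₁, h₂]
  | left u r c ih => simp only [vertexOf, numLeaves]; omega
  | right u l c ih => simp only [vertexOf, numLeaves]; omega

theorem mem_fan {T : BinaryTree Unit} (c : Caret T) (b : Bool) (v : ℕ) :
    (c, b) ∈ fan T v ↔ v = vertexOf c b := by
  induction c generalizing v with
  | top u l r =>
    have h₁ := l.numLeaves_pos
    by_cases hv : v < l.numLeaves
    · by_cases h0 : v = 0 <;> cases b <;> simp [fan, hv, vertexOf, h0, h₁] <;> omega
    · by_cases h0 : v = l.numLeaves <;> cases b <;> simp [fan, hv, vertexOf, h0] <;> omega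
  | @left u l r c ih =>
    have hlt := vertexOf_lt c b
    by_cases hv : v < l.numLeaves
    · by_cases h0 : v = 0 <;> simp_all [fan, vertexOf]
    · by_cases h0 : v = l.numLeaves <;> simp [fan, hv, vertexOf, h0] <;> omega
  | right u l c ih =>
    by_cases hv : v < l.numLeaves
    · by_cases h0 : v = 0 <;> simp_all [fan, vertexOf] <;> omega
    · by_cases h0 : v = l.numLeaves <;> simp [fan, hv, vertexOf, h0, ih] <;> omega

/-- The graph `Γ(S, T)`: `S` is placed in the upper half plane and gives the positive edges, and
`T` is placed upside down (by reflection) in the lower half plane and gives the negative edges. -/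
def gamma (S T : BinaryTree Unit) (h : S.numLeaves = T.numLeaves) :
    SignedPlaneGraph S.numLeaves (Caret S ⊕ Caret T) where
  positive e := e.isLeft
  rot v := (fan S v).map (Prod.map Sum.inl id) ++ ((fan T v).map (Prod.map Sum.inr id)).reverse
  nodup v := by
    refine List.Nodup.append
      ((nodup_fan S v).map (Function.Injective.prodMap Sum.inl_injective Function.injective_id))
      (List.nodup_reverse.2 ((nodup_fan T v).map
        (Function.Injective.prodMap Sum.inr_injective Function.injective_id))) ?_
    intro d hd hd'
    obtain ⟨a, -, rfl⟩ := List.mem_map.1 hd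
    obtain ⟨b, -, hb⟩ := List.mem_map.1 (List.mem_reverse.1 hd')
    exact Sum.inr_ne_inl (Prod.ext_iff.1 hb).1
  existsUnique := by
    rintro ⟨c | c, b⟩
    · refine ⟨⟨vertexOf c b, vertexOf_lt c b⟩, ?_, ?_⟩
      · simp [mem_fan]
      · intro v hv
        simp [mem_fan] at hv
        exact Fin.ext hv
    · refine ⟨⟨vertexOf c b, h ▸ vertexOf_lt c b⟩, ?_, ?_⟩
      · simp [mem_fan]
      · intro v hv
        simp [mem_fan] at hv
        exact Fin.ext hv

theorem inl_mem_rot (S T : BinaryTree Unit) (h : S.numLeaves = T.numLeaves) (c : Caret S)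
    (b : Bool) (v : Fin S.numLeaves) :
    (Sum.inl c, b) ∈ (gamma S T h).rot v ↔ (v : ℕ) = vertexOf c b := by
  simp [gamma, mem_fan]

theorem inr_mem_rot (S T : BinaryTree Unit) (h : S.numLeaves = T.numLeaves) (c : Caret T)
    (b : Bool) (v : Fin S.numLeaves) :
    (Sum.inr c, b) ∈ (gamma S T h).rot v ↔ (v : ℕ) = vertexOf c b := by
  simp [gamma, mem_fan]

/-- The link diagram `L(S, T)`. -/
def link (S T : BinaryTree Unit) (h : S.numLeaves = T.numLeaves) :
    LinkDiagram (((Caret S ⊕ Caret T) × Bool) ⊕ {v : Fin S.numLeaves // (gamma S T h).rot v = []})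
      (Caret S ⊕ Caret T) :=
  (gamma S T h).medial

/-- The function `c(g) = c(L(S, T)) - n` on the Thompson group, for a pair of trees `(S, T)` with
`n` leaves that represents `g`. -/
def linkExponent (g : ThompsonF) : ℤ :=
  ((link g.2.choose g.2.choose_spec.choose g.2.choose_spec.choose_spec.choose).numComponents : ℤ) -
    (g.2.choose.numLeaves : ℤ)

/-! ### The Jones-Thompson group -/

/-- Parity of the number of right turns on the way from the root to a leaf. -/
def leafColor : BinaryTree Unit → ℕ → Bool
  | nil, _ => false
  | node _ l r, v => if v < l.numLeaves then leafColor l v else !leafColor r (v - l.numLeaves)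

theorem leafColor_zero (T : BinaryTree Unit) : leafColor T 0 = false := by
  induction T with
  | nil => rfl
  | node u l r hl hr => simp [leafColor, l.numLeaves_pos, hl]

theorem leafColor_ne {T : BinaryTree Unit} (c : Caret T) :
    leafColor T (vertexOf c false) ≠ leafColor T (vertexOf c true) := by
  induction c with
  | top u l r => simp [vertexOf, leafColor, l.numLeaves_pos, leafColor_zero]
  | left u r c ih => simpa [vertexOf, leafColor, vertexOf_lt] using ih
  | right u l c ih => simpa [vertexOf, leafColor] using ih

theorem eq_leafColor (T : BinaryTree Unit) (f : ℕ → Bool)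
    (hf : ∀ c : Caret T, f (vertexOf c false) ≠ f (vertexOf c true)) (v : ℕ)
    (hv : v < T.numLeaves) : f v = (f 0 ^^ leafColor T v) := by
  induction T generalizing f v with
  | nil =>
    simp only [numLeaves, Nat.lt_one_iff] at hv
    simp [hv, leafColor]
  | node u l r hl hr =>
    simp only [numLeaves] at hv
    by_cases h : v < l.numLeaves
    · simpa [leafColor, h] using hl f (fun c => hf (.left u r c)) v h
    · have h1 := hr (fun i => f (l.numLeaves + i)) (fun c => hf (.right u l c))
        (v - l.numLeaves) (by omega)
      have h2 : f 0 ≠ f l.numLeaves := hf (.top u l r)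
      have h3 : l.numLeaves + (v - l.numLeaves) = v := by omega
      simp only [h3, add_zero] at h1
      rw [h1]
      simp only [leafColor, h, if_false]
      revert h2
      cases f 0 <;> cases f l.numLeaves <;> simp

theorem isBipartite_gamma_iff (S T : BinaryTree Unit) (h : S.numLeaves = T.numLeaves) :
    (gamma S T h).toSimpleGraph.IsBipartite ↔
      ∀ v < S.numLeaves, leafColor S v = leafColor T v := by
  constructor
  · rintro ⟨C⟩ v hv
    let f : ℕ → Bool := fun i => if hi : i < S.numLeaves then decide (C ⟨i, hi⟩ = 0) else false
    have adj : ∀ a b : Fin S.numLeaves, (gamma S T h).toSimpleGraph.Adj a b →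
        f a ≠ f b := by
      intro a b hab
      have := C.valid hab
      have e1 : C a = 0 ∨ C a = 1 := by omega
      have e2 : C b = 0 ∨ C b = 1 := by omega
      simp only [f, Fin.is_lt, dite_true, Fin.eta]
      rcases e1 with e1 | e1 <;> rcases e2 with e2 | e2 <;> simp_all
    have hS : ∀ c : Caret S, f (vertexOf c false) ≠ f (vertexOf c true) := by
      intro c
      refine adj ⟨_, vertexOf_lt c false⟩ ⟨_, vertexOf_lt c true⟩ ?_
      refine (SimpleGraph.fromRel_adj _ _ _).2 ⟨fun e => ?_, Or.inl ⟨Sum.inl c, ?_, ?_⟩⟩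
      · exact leafColor_ne c (congrArg _ (Fin.ext_iff.1 e))
      · rw [inl_mem_rot]
      · rw [inl_mem_rot]
    have hT : ∀ c : Caret T, f (vertexOf c false) ≠ f (vertexOf c true) := by
      intro c
      refine adj ⟨_, h ▸ vertexOf_lt c false⟩ ⟨_, h ▸ vertexOf_lt c true⟩ ?_
      refine (SimpleGraph.fromRel_adj _ _ _).2 ⟨fun e => ?_, Or.inl ⟨Sum.inr c, ?_, ?_⟩⟩
      · exact leafColor_ne c (congrArg _ (Fin.ext_iff.1 e))
      · rw [inr_mem_rot]
      · rw [inr_mem_rot]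
    have h1 := eq_leafColor S f hS v hv
    have h2 := eq_leafColor T f hT v (h ▸ hv)
    rw [h1] at h2
    simpa using h2
  · intro hc
    have key : ∀ a b : Fin S.numLeaves, (∃ e, (e, false) ∈ (gamma S T h).rot a ∧
        (e, true) ∈ (gamma S T h).rot b) → leafColor S a ≠ leafColor S b := by
      rintro a b ⟨c | c, ha, hb⟩
      · rw [inl_mem_rot] at ha hb
        rw [ha, hb]
        exact leafColor_ne c
      · rw [inr_mem_rot] at ha hb
        rw [hc a a.2, hc b b.2, ha, hb]
        exact leafColor_ne c
    let C : (gamma S T h).toSimpleGraph.Coloring Bool :=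
      SimpleGraph.Coloring.mk (fun v => leafColor S v) (by
        intro a b hab
        obtain ⟨-, h' | h'⟩ := (SimpleGraph.fromRel_adj _ _ _).1 hab
        · exact key a b h'
        · exact (key b a h').symm)
    simpa using C.colorable

theorem leafColor_graft (T : BinaryTree Unit) (s : ℕ → BinaryTree Unit) (x : Cantor) :
    leafColor (graft T s) (leafOf (graft T s) x) =
      (leafColor T (leafOf T x) ^^
        leafColor (s (leafOf T x)) (leafOf (s (leafOf T x)) (tailOf T x))) := by
  induction T generalizing s x with
  | nil => simp [graft, leafColor, leafOf_nil, tailOf_nil]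
  | node u l r hl hr =>
    simp only [graft, leafOf_node, tailOf_node]
    cases h : x 0
    · simp [leafColor, leafOf_lt, hl]
    · simp [leafColor, hr]

theorem isBipartite_graft (S T : BinaryTree Unit) (h : S.numLeaves = T.numLeaves)
    (s : ℕ → BinaryTree Unit) (hb : ∀ v < S.numLeaves, leafColor S v = leafColor T v) :
    ∀ v < (graft S s).numLeaves, leafColor (graft S s) v = leafColor (graft T s) v := by
  intro v hv
  obtain ⟨x, rfl⟩ := exists_leafOf (graft S s) hv
  have e : leafOf (graft S s) x = leafOf (graft T s) (ofTrees T S h.symm x) := by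
    rw [leafOf_graft, leafOf_graft, leafOf_ofTrees, tailOf_ofTrees]
  rw [leafColor_graft, e, leafColor_graft, leafOf_ofTrees, tailOf_ofTrees, hb _ (leafOf_lt S x)]

/-- The Jones-Thompson group `F⃗`: the subgroup of those `g(S, T)` for which the graph `Γ(S, T)`
is bipartite. -/
def JonesF : Subgroup ThompsonF where
  carrier := {g | ∃ S T h, g = element S T h ∧ (gamma S T h).toSimpleGraph.IsBipartite}
  mul_mem' := by
    rintro _ _ ⟨S, T, h, rfl, hb⟩ ⟨S', T', h', rfl, hb'⟩
    obtain ⟨s, t, e, hst, he⟩ := exists_common S T S' T' h h'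
    refine ⟨_, _, e, Subtype.ext he, ?_⟩
    rw [isBipartite_gamma_iff] at hb hb' ⊢
    intro v hv
    rw [isBipartite_graft S T h s hb v hv, hst]
    refine isBipartite_graft S' T' h' t hb' v ?_
    rw [← hst, numLeaves_graft, ← h, ← numLeaves_graft]
    exact hv
  one_mem' := by
    refine ⟨nil, nil, rfl, Subtype.ext (ofTrees_self nil).symm, ?_⟩
    rw [isBipartite_gamma_iff]
    exact fun _ _ => rfl
  inv_mem' := by
    rintro _ ⟨S, T, h, rfl, hb⟩
    refine ⟨T, S, h.symm, Subtype.ext (ofTrees_inv S T h), ?_⟩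
    rw [isBipartite_gamma_iff] at hb ⊢
    exact fun v hv => (hb v (h ▸ hv)).symm

/-! ### Functions of positive type -/

open scoped ComplexOrder in
/-- A complex function on a group is of positive type if all matrices `(φ (gᵢ gⱼ⁻¹))ᵢⱼ` are
positive semidefinite. -/
def IsOfPositiveType {G : Type*} [Group G] (φ : G → ℂ) : Prop :=
  ∀ (r : ℕ) (g : Fin r → G), (Matrix.of fun i j => φ (g i * (g j)⁻¹)).PosSemidef

end JonesThompson

end

/-!
The axis cuts the link `L(S, T)` into two tangles, each of which joins in pairs the `2n` points
where the small circles around the `n` vertices meet the axis. The pairing depends only on the tree,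
and is described recursively by `Compat`. Labelling the components of the link by elements of a set
`X` amounts to labelling the `2n` points compatibly with both pairings, so that the number of such
labels is `|X| ^ c(L)` (`card_states`).

*Invariance.* A pair of opposing carets adds a vertex and a component (`numComponents_addCaret`), so
that `c(L) - n` does not change. Two pairs of trees that represent the same element become equal
after adding opposing carets, since the trees of a pair determine each other once the element is
given (`eq_of_ofTrees_eq`).

*Positivity for `k > 0`.* Write finitely many elements as `g(A i, B)` with a common `B`; then
`g i * (g j)⁻¹ = g(A i, A j)`, and `k ^ c(L(A i, A j))` is the inner product of the indicator
functions of the labels, in a set with `k` elements, that are compatible with `A i` and with `A j`.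
The common factor `k ^ (-n)` is positive.

*Negative `k`.* On the Jones-Thompson group the exponent is even (`even_linkExponent`), so `k` may
be replaced by `|k|`. Indeed, if the graph is bipartite, then the strands of both tangles can be
oriented compatibly, and become two permutations of the `n` vertices. Each has the sign
`(-1) ^ (n + 1)` by induction on the tree (`exists_perm`). The components of the link are the cycles
of an even permutation of `n` points, and hence their number has the parity of `n`.
-/

noncomputable section

namespace JonesThompson

open BinaryTree

/-! ### Labels along a list of half-edges -/

/-- Read along the list `l`, the labels fit together from `x` to `y`: the label `b d` before a
member `d` of `l` is the label after the previous member (`x` for the first member), and `y` is the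
label after the last member (`x = y` if `l` is empty). -/
def Threads {D X : Type*} (b a : D → X) : X → List D → X → Prop
  | x, [], y => x = y
  | x, d :: l, y => b d = x ∧ Threads b a (a d) l y

section Threads

variable {D D' X : Type*} (b a : D → X)

theorem threads_append (x : X) (l₁ l₂ : List D) (y : X) :
    Threads b a x (l₁ ++ l₂) y ↔ ∃ z, Threads b a x l₁ z ∧ Threads b a z l₂ y := by
  induction l₁ generalizing x with
  | nil => simp [Threads]
  | cons d l ih => simp [Threads, ih, and_assoc]

theorem threads_singleton (x : X) (d : D) (y : X) :
    Threads b a x [d] y ↔ b d = x ∧ a d = y := Iff.rfl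

theorem threads_map (h : D' → D) (x : X) (l : List D') (y : X) :
    Threads b a x (l.map h) y ↔ Threads (fun d => b (h d)) (fun d => a (h d)) x l y := by
  induction l generalizing x with
  | nil => simp [Threads]
  | cons d l ih => simp [Threads, ih]

theorem threads_reverse (x : X) (l : List D) (y : X) :
    Threads b a x l.reverse y ↔ Threads a b y l x := by
  induction l generalizing y with
  | nil => simp [Threads, eq_comm]
  | cons d l ih =>
    simp only [List.reverse_cons, threads_append, Threads, ih]
    constructor
    · rintro ⟨z, h, rfl, rfl⟩
      exact ⟨rfl, h⟩
    · rintro ⟨rfl, h⟩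
      exact ⟨_, h, rfl, rfl⟩

theorem Threads.right_unique {b a : D → X} {x : X} {l : List D} {y z : X}
    (h : Threads b a x l y) (h' : Threads b a x l z) : y = z := by
  induction l generalizing x with
  | nil => exact h.symm.trans h'
  | cons d l ih => exact ih h.2 h'.2

theorem exists_threads {l : List D} {x : X}
    (hx : ∀ h : l ≠ [], b (l.head h) = x)
    (hs : ∀ (i : ℕ) (hi : i + 1 < l.length), b l[i + 1] = a l[i]) :
    ∃ y, Threads b a x l y := by
  induction l generalizing x with
  | nil => exact ⟨x, rfl⟩
  | cons d l ih =>
    obtain ⟨y, hy⟩ := ih (x := a d)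
      (by
        intro h
        have := hs 0 (by simpa [List.length_pos_iff] using h)
        simpa [List.head_eq_getElem] using this)
      (fun i hi => hs (i + 1) (Nat.succ_lt_succ hi))
    exact ⟨y, hx (by simp), hy⟩

theorem Threads.head {b a : D → X} {x : X} {l : List D} {y : X} (h : Threads b a x l y)
    (hl : l ≠ []) : b (l.head hl) = x := by
  cases l with
  | nil => exact absurd rfl hl
  | cons d l => exact h.1

theorem Threads.getLast {b a : D → X} {x : X} {l : List D} {y : X} (h : Threads b a x l y)
    (hl : l ≠ []) : a (l.getLast hl) = y := by
  have h' := (threads_reverse a b y l x).2 h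
  have := h'.head (by simpa using hl)
  simpa using this

theorem Threads.getElem {b a : D → X} {x : X} {l : List D} {y : X} (h : Threads b a x l y)
    (i : ℕ) (hi : i + 1 < l.length) : b l[i + 1] = a l[i] := by
  induction l generalizing x i with
  | nil => simp at hi
  | cons d l ih =>
    cases i with
    | zero =>
      have := h.2.head (by rintro rfl; simp at hi)
      simpa [List.head_eq_getElem] using this
    | succ i => simpa using ih h.2 i (by simpa using hi)

/-- The labels fit together around the cycle `l` if and only if the label before the successor of a
member of `l` is always the label after this member. -/
theorem threads_formPerm_iff [DecidableEq D] {l : List D} (hl : l.Nodup) (x : X) :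
    Threads b a x l x ↔ (∀ d ∈ l, b (l.formPerm d) = a d) ∧
      ∀ h : l ≠ [], a (l.getLast h) = x := by
  constructor
  · intro h
    refine ⟨fun d hd => ?_, h.getLast⟩
    obtain ⟨i, hi, rfl⟩ := List.getElem_of_mem hd
    rcases Nat.lt_or_ge (i + 1) l.length with hi' | hi'
    · rw [List.formPerm_apply_lt_getElem _ hl _ hi', h.getElem i hi']
    · have hn : l ≠ [] := List.ne_nil_of_mem hd
      have h1 := h.head hn
      have h2 := h.getLast hn
      have e : i + 1 = l.length := by omega
      rw [List.formPerm_apply_getElem _ hl]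
      simp only [e, Nat.mod_self]
      rw [List.head_eq_getElem] at h1
      rw [List.getLast_eq_getElem] at h2
      simp only [← e, Nat.add_sub_cancel] at h2
      rw [h1, h2]
  · rintro ⟨h1, h2⟩
    rcases eq_or_ne l [] with rfl | hn
    · rfl
    have hpos := List.length_pos_iff.2 hn
    obtain ⟨y, hy⟩ := exists_threads b a (l := l) (x := x)
      (by
        intro h
        have := h1 _ (List.getLast_mem h)
        rw [List.getLast_eq_getElem, List.formPerm_apply_getElem _ hl] at this
        have e : l.length - 1 + 1 = l.length := by omega
        simp only [e, Nat.mod_self] at this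
        rw [List.head_eq_getElem, this, ← List.getLast_eq_getElem h, h2])
      (by
        intro i hi
        rw [← h1 _ (List.getElem_mem _), List.formPerm_apply_lt_getElem _ hl _ hi])
    rwa [← hy.getLast hn, h2 hn] at hy

end Threads

/-! ### The tangle of a tree -/

section Compat

variable {X : Type*}

/-- The tangle of a tree `T` with `n` leaves. A small circle around each vertex `v` meets the axis
in a point to the right of `v` and in a point to its left, labelled `R v` and `L v`. The half of
the medial diagram that lies above the axis joins these `2n` points in pairs, and `Compat T R L`
says that joined points have equal labels. For a caret with first vertices `0` and `m` of its two
subtrees, the left points of `0` and `m` are joined, and the strands that start at these points in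
the tangles of the subtrees are linked with each other; `y` is the label of the latter strand. Only
labels of vertices less than `n` matter. -/
def Compat : BinaryTree Unit → (ℕ → X) → (ℕ → X) → Prop
  | nil, R, L => R 0 = L 0
  | node _ l r, R, L => L 0 = L l.numLeaves ∧ ∃ y, Compat l R (Function.update L 0 y) ∧
      Compat r (fun i => R (l.numLeaves + i))
        (Function.update (fun i => L (l.numLeaves + i)) 0 y)

theorem compat_congr (T : BinaryTree Unit) {R L R' L' : ℕ → X}
    (hR : ∀ v < T.numLeaves, R v = R' v) (hL : ∀ v < T.numLeaves, L v = L' v) :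
    Compat T R L ↔ Compat T R' L' := by
  induction T generalizing R L R' L' with
  | nil => simp [Compat, hR 0 (by simp), hL 0 (by simp)]
  | node u l r hl hr =>
    have h₁ := l.numLeaves_pos
    have h₂ := r.numLeaves_pos
    simp only [numLeaves] at hR hL
    simp only [Compat]
    rw [hL 0 (by omega), hL l.numLeaves (by omega)]
    refine and_congr_right fun _ => exists_congr fun y => and_congr
      (hl (fun v hv => hR v (by omega)) fun v hv => ?_)
      (hr (fun v hv => hR _ (by omega)) fun v hv => ?_)
    · simp only [Function.update_apply]
      split_ifs
      exacts [rfl, hL v (by omega)]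
    · simp only [Function.update_apply]
      split_ifs
      exacts [rfl, hL _ (by omega)]

/-- The left point of the vertex `0` is joined to another point, so its label is determined by the
other labels. -/
theorem Compat.eq_of_update {T : BinaryTree Unit} {R L : ℕ → X} {y z : X}
    (h : Compat T R (Function.update L 0 y)) (h' : Compat T R (Function.update L 0 z)) :
    y = z := by
  cases T with
  | nil =>
    simp only [Compat, Function.update_self] at h h'
    exact h.symm.trans h'
  | node u l r =>
    have h₁ := h.1
    have h₂ := h'.1
    rw [Function.update_self, Function.update_of_ne l.numLeaves_pos.ne'] at h₁ h₂
    exact h₁.trans h₂.symm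

/-- The labels `B c` before and `A c` after the two halves of the edge of each caret `c`, counted in
the direction from the right to the left of a vertex, extend the labels on the axis to labels of
all corners above the axis that are constant along strands. Being constant along strands at the
crossing of `c` is built in, as both halves of its edge carry the same two labels. -/
def HalfPlane (T : BinaryTree Unit) (B A : Caret T → X) (R L : ℕ → X) : Prop :=
  ∀ v < T.numLeaves, Threads (fun d => B d.1) (fun d => A d.1) (R v) (fan T v) (L v)

/-- The edge of the top caret is the leftmost one at both of its ends; the label before it takes the
place of the label of the left point in the subtrees. -/
theorem halfPlane_node (u : Unit) (l r : BinaryTree Unit) (B A : Caret (node u l r) → X)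
    (R L : ℕ → X) :
    HalfPlane (node u l r) B A R L ↔
      A (.top u l r) = L 0 ∧ A (.top u l r) = L l.numLeaves ∧
      HalfPlane l (fun c => B (.left u r c)) (fun c => A (.left u r c)) R
        (Function.update L 0 (B (.top u l r))) ∧
      HalfPlane r (fun c => B (.right u l c)) (fun c => A (.right u l c))
        (fun i => R (l.numLeaves + i))
        (Function.update (fun i => L (l.numLeaves + i)) 0 (B (.top u l r))) := by
  have h₁ := l.numLeaves_pos
  have h₂ := r.numLeaves_pos
  have kl : ∀ v < l.numLeaves, (Threads (fun d => B d.1) (fun d => A d.1) (R v)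
      (fan (node u l r) v) (L v) ↔ (v = 0 → A (.top u l r) = L 0) ∧
      Threads (fun d => B (.left u r d.1)) (fun d => A (.left u r d.1)) (R v) (fan l v)
        (Function.update L 0 (B (.top u l r)) v)) := by
    intro v hv
    rcases eq_or_ne v 0 with rfl | h0
    · simp [fan, hv, threads_append, threads_map, threads_singleton, and_comm]
    · simp [fan, hv, h0, threads_map]
  have kr : ∀ v < r.numLeaves, (Threads (fun d => B d.1) (fun d => A d.1) (R (l.numLeaves + v))
      (fan (node u l r) (l.numLeaves + v)) (L (l.numLeaves + v)) ↔
      (v = 0 → A (.top u l r) = L l.numLeaves) ∧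
      Threads (fun d => B (.right u l d.1)) (fun d => A (.right u l d.1))
        (R (l.numLeaves + v)) (fan r v)
        (Function.update (fun i => L (l.numLeaves + i)) 0 (B (.top u l r)) v)) := by
    intro v hv
    rcases eq_or_ne v 0 with rfl | h0
    · simp [fan, threads_append, threads_map, threads_singleton, and_comm]
    · simp [fan, h0, threads_map]
  constructor
  · intro h
    have hl := fun v (hv : v < l.numLeaves) => (kl v hv).1 (h v (by simp [numLeaves]; omega))
    have hr := fun v (hv : v < r.numLeaves) =>
      (kr v hv).1 (h (l.numLeaves + v) (by simp [numLeaves]; omega))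
    exact ⟨(hl 0 h₁).1 rfl, (hr 0 h₂).1 rfl, fun v hv => (hl v hv).2, fun v hv => (hr v hv).2⟩
  · rintro ⟨h0, hm, hl, hr⟩ v hv
    simp only [numLeaves] at hv
    rcases Nat.lt_or_ge v l.numLeaves with h | h
    · exact (kl v h).2 ⟨fun _ => h0, hl v h⟩
    · obtain ⟨w, rfl⟩ := Nat.exists_eq_add_of_le h
      exact (kr w (by omega)).2 ⟨fun _ => hm, hr w (by omega)⟩

theorem HalfPlane.compat {T : BinaryTree Unit} {B A : Caret T → X} {R L : ℕ → X}
    (h : HalfPlane T B A R L) : Compat T R L := by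
  induction T generalizing R L with
  | nil => exact h 0 (by simp)
  | node u l r hl hr =>
    obtain ⟨h0, hm, h₁, h₂⟩ := (halfPlane_node u l r B A R L).1 h
    exact ⟨h0.symm.trans hm, _, hl h₁, hr h₂⟩

theorem Compat.exists_halfPlane {T : BinaryTree Unit} {R L : ℕ → X} (h : Compat T R L) :
    ∃ B A, HalfPlane T B A R L := by
  induction T generalizing R L with
  | nil =>
    refine ⟨fun _ => R 0, fun _ => R 0, fun v hv => ?_⟩
    simp only [numLeaves, Nat.lt_one_iff] at hv
    subst hv
    exact h
  | node u l r hl hr =>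
    obtain ⟨h0, y, h₁, h₂⟩ := h
    obtain ⟨B₁, A₁, h₁⟩ := hl h₁
    obtain ⟨B₂, A₂, h₂⟩ := hr h₂
    refine ⟨fun c => match c with
      | .top _ _ _ => y
      | .left _ _ c => B₁ c
      | .right _ _ c => B₂ c, fun c => match c with
      | .top _ _ _ => L 0
      | .left _ _ c => A₁ c
      | .right _ _ c => A₂ c, ?_⟩
    rw [halfPlane_node]
    exact ⟨rfl, h0, h₁, h₂⟩

theorem HalfPlane.unique {T : BinaryTree Unit} {B A B' A' : Caret T → X} {R L : ℕ → X}
    (h : HalfPlane T B A R L) (h' : HalfPlane T B' A' R L) : B = B' ∧ A = A' := by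
  induction T generalizing R L with
  | nil => exact ⟨funext fun c => (nomatch c), funext fun c => (nomatch c)⟩
  | node u l r hl hr =>
    obtain ⟨h0, hm, h₁, h₂⟩ := (halfPlane_node u l r B A R L).1 h
    obtain ⟨h0', hm', h₁', h₂'⟩ := (halfPlane_node u l r B' A' R L).1 h'
    have e := h₁.compat.eq_of_update h₁'.compat
    rw [← e] at h₁' h₂'
    obtain ⟨e₁, e₂⟩ := hl h₁ h₁'
    obtain ⟨e₃, e₄⟩ := hr h₂ h₂'
    refine ⟨funext fun c => ?_, funext fun c => ?_⟩
    · match c with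
      | .top _ _ _ => exact e
      | .left _ _ c => exact congrFun e₁ c
      | .right _ _ c => exact congrFun e₃ c
    · match c with
      | .top _ _ _ => exact h0.trans h0'.symm
      | .left _ _ c => exact congrFun e₂ c
      | .right _ _ c => exact congrFun e₄ c

end Compat

/-! ### Labellings of the components of a link -/

open scoped Classical in
/-- The lists `rot v` are disjoint, so that only one factor of `rotPerm` moves a given half-edge. -/
theorem SignedPlaneGraph.rotPerm_apply {n : ℕ} {Edge : Type} (G : SignedPlaneGraph n Edge)
    {v : Fin n} {d : Edge × Bool} (hd : d ∈ G.rot v) : G.rotPerm d = (G.rot v).formPerm d := by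
  have key : ∀ l : List (Fin n), l.Nodup → (l.map fun v => (G.rot v).formPerm).prod d =
      if v ∈ l then (G.rot v).formPerm d else d := by
    intro l hl
    induction l with
    | nil => simp
    | cons w l ih =>
      rw [List.nodup_cons] at hl
      simp only [List.map_cons, List.prod_cons, Equiv.Perm.mul_apply, ih hl.2, List.mem_cons]
      rcases eq_or_ne v w with rfl | hvw
      · simp [hl.1]
      · have : ∀ d' ∈ G.rot v, (G.rot w).formPerm d' = d' := fun d' h' =>
          List.formPerm_apply_of_notMem fun h =>
            hvw ((G.existsUnique d').unique h' h)
        simp only [hvw, false_or]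
        split_ifs
        · exact this _ (List.formPerm_apply_mem_of_mem hd)
        · exact this _ hd
  rw [SignedPlaneGraph.rotPerm, key _ (List.nodup_finRange n), if_pos (List.mem_finRange v)]

/-- The signs do not affect which arcs continue each other. -/
theorem medial_continues_iff {n : ℕ} {Edge X : Type} (G : SignedPlaneGraph n Edge)
    (f : (Edge × Bool) ⊕ {v : Fin n // G.rot v = []} → X) :
    (∀ x y, G.medial.Continues x y → f x = f y) ↔
      ∀ e, f (.inl (e, false)) = f (.inl (e, true)) ∧
        f (.inl (G.rotPerm⁻¹ (e, false))) = f (.inl (G.rotPerm⁻¹ (e, true))) := by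
  constructor
  · intro h e
    by_cases he : G.positive e
    · exact ⟨h _ _ ⟨e, .inl (by simp [SignedPlaneGraph.medial, he])⟩,
        h _ _ ⟨e, .inr (by simp [SignedPlaneGraph.medial, he])⟩⟩
    · exact ⟨(h _ _ ⟨e, .inr (by simp [SignedPlaneGraph.medial, he])⟩).symm,
        h _ _ ⟨e, .inl (by simp [SignedPlaneGraph.medial, he])⟩⟩
  · rintro h x y ⟨e, ⟨rfl, rfl⟩ | ⟨rfl, rfl⟩⟩ <;>
    by_cases he : G.positive e <;>
    simp only [SignedPlaneGraph.medial, he, if_true, if_false]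
    exacts [(h e).1, (h e).2, (h e).2, (h e).1.symm]

/-- A labelling of the arcs that is constant along strands is a labelling of the components. -/
theorem LinkDiagram.card_pow_numComponents {Arc Crossing : Type} (D : LinkDiagram Arc Crossing)
    (X : Type*) :
    Nat.card {f : Arc → X // ∀ x y, D.Continues x y → f x = f y} =
      Nat.card X ^ D.numComponents := by
  have := D.finite_arc
  have : Finite (Quot D.Continues) := Quot.finite _
  rw [LinkDiagram.numComponents, ← Nat.card_fun]
  exact Nat.card_congr
    { toFun := fun f => Quot.lift f.1 f.2
      invFun := fun g => ⟨fun x => g (Quot.mk _ x), fun x y h => congrArg g (Quot.sound h)⟩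
      left_inv := fun f => rfl
      right_inv := fun g => by ext ⟨x⟩; rfl }

theorem card_eq_of_existsUnique {α β : Type*} (r : α → β → Prop) (h : ∀ x, ∃! y, r x y)
    (h' : ∀ y, ∃! x, r x y) : Nat.card α = Nat.card β := by
  choose f hf hf' using h
  refine Nat.card_eq_of_bijective f ⟨fun x x' e => ?_, fun y => ?_⟩
  · exact (h' (f x)).unique (hf x) (e ▸ hf x')
  · obtain ⟨x, hx, -⟩ := h' y
    exact ⟨x, (hf' x y hx).symm⟩

/-- Around a vertex of `Γ(S, T)` the corners are read from right to left above the axis and from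
left to right below it. Reading the lower half backwards exchanges "before" and "after". -/
theorem threads_rot (S T : BinaryTree Unit) (h : S.numLeaves = T.numLeaves)
    {X : Type*} (b a : (Caret S ⊕ Caret T) × Bool → X) (v : Fin S.numLeaves) (x : X) :
    Threads b a x ((gamma S T h).rot v) x ↔
      ∃ z, Threads (fun d => b (.inl d.1, d.2)) (fun d => a (.inl d.1, d.2)) x (fan S v) z ∧
        Threads (fun d => a (.inr d.1, d.2)) (fun d => b (.inr d.1, d.2)) x (fan T v) z := by
  simp only [gamma, threads_append, threads_reverse, threads_map]
  rfl

theorem threads_rot_iff (S T : BinaryTree Unit) (h : S.numLeaves = T.numLeaves)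
    {X : Type*} (b a : (Caret S ⊕ Caret T) × Bool → X) (v : Fin S.numLeaves) (x : X) :
    Threads b a x ((gamma S T h).rot v) x ↔
      (∀ d ∈ (gamma S T h).rot v, b ((gamma S T h).rotPerm d) = a d) ∧
        ∀ hn : (gamma S T h).rot v ≠ [], a (((gamma S T h).rot v).getLast hn) = x := by
  classical
  rw [threads_formPerm_iff b a ((gamma S T h).nodup v)]
  refine and_congr_left fun _ => forall₂_congr fun d hd => ?_
  rw [(gamma S T h).rotPerm_apply hd]
  congr!

section

variable (X : Type) [Inhabited X]

/-- Labels `(R, L)` of the right and left points of the vertices less than `n`. They are total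
functions with the value `default` from `n` on, so that `Compat` applies to them directly. -/
abbrev Labels (n : ℕ) : Type :=
  {P : (ℕ → X) × (ℕ → X) // ∀ i, n ≤ i → P.1 i = default ∧ P.2 i = default}

def labelsEquiv (n : ℕ) : Labels X n ≃ (Fin n → X) × (Fin n → X) where
  toFun P := (fun i => P.1.1 i, fun i => P.1.2 i)
  invFun Q := ⟨(fun i => if h : i < n then Q.1 ⟨i, h⟩ else default,
    fun i => if h : i < n then Q.2 ⟨i, h⟩ else default), fun i hi => by simp [hi.not_gt]⟩
  left_inv P := by
    refine Subtype.ext (Prod.ext (funext fun i => ?_) (funext fun i => ?_))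
    · rcases Nat.lt_or_ge i n with h | h
      · simp [h]
      · simp [h.not_gt, (P.2 i h).1]
    · rcases Nat.lt_or_ge i n with h | h
      · simp [h]
      · simp [h.not_gt, (P.2 i h).2]
  right_inv Q := by simp

variable {X} in
theorem labelsEquiv_symm_apply {n : ℕ} (Q : (Fin n → X) × (Fin n → X)) (v : Fin n) :
    ((labelsEquiv X n).symm Q).1.1 v = Q.1 v ∧ ((labelsEquiv X n).symm Q).1.2 v = Q.2 v := by
  have h := (labelsEquiv X n).apply_symm_apply Q
  exact ⟨congrFun (congrArg Prod.fst h) v, congrFun (congrArg Prod.snd h) v⟩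

instance [Finite X] (n : ℕ) : Finite (Labels X n) := Finite.of_equiv _ (labelsEquiv X n).symm

/-- Labels of the points on the axis that are compatible with the upper tangle, of `S`, and with the
lower one, of `T`. -/
abbrev States (S T : BinaryTree Unit) : Type :=
  {P : Labels X S.numLeaves // Compat S P.1.1 P.1.2 ∧ Compat T P.1.1 P.1.2}

variable {X}

/-- The link is glued from the tangles of the two trees: its components are labelled by labelling
the points on the axis compatibly with both of them. -/
theorem card_states (S T : BinaryTree Unit) (h : S.numLeaves = T.numLeaves) :
    Nat.card (States X S T) = Nat.card X ^ (link S T h).numComponents := by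
  rw [← LinkDiagram.card_pow_numComponents]
  symm
  set G := gamma S T h with hG
  -- `f` induces `P`: at each vertex the corners of `f` lead from the right to the left point
  -- on both sides of the axis, with the labels of `P` there
  refine card_eq_of_existsUnique (fun f P => ∀ v : Fin S.numLeaves,
    (∀ hv : G.rot v = [], f.1 (.inr ⟨v, hv⟩) = P.1.1.1 v) ∧
    Threads (fun d => f.1 (.inl (G.rotPerm⁻¹ (.inl d.1, d.2))))
      (fun d => f.1 (.inl (.inl d.1, d.2)))
      (P.1.1.1 v) (fan S v) (P.1.1.2 v) ∧
    Threads (fun d => f.1 (.inl (.inr d.1, d.2)))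
      (fun d => f.1 (.inl (G.rotPerm⁻¹ (.inr d.1, d.2))))
      (P.1.1.1 v) (fan T v) (P.1.1.2 v)) ?_ ?_
  · rintro ⟨f, hf⟩
    rw [link, medial_continues_iff] at hf
    let B : Caret S ⊕ Caret T → X := fun e => f (.inl (G.rotPerm⁻¹ (e, false)))
    let A : Caret S ⊕ Caret T → X := fun e => f (.inl (e, false))
    have hB : ∀ e b, f (.inl (G.rotPerm⁻¹ (e, b))) = B e := by
      rintro e (_ | _)
      exacts [rfl, (hf e).2.symm]
    have hA : ∀ c b, f (.inl (.inl c, b)) = A (.inl c) := by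
      rintro c (_ | _)
      exacts [rfl, (hf _).1.symm]
    have hA' : ∀ c b, f (.inl (.inr c, b)) = A (.inr c) := by
      rintro c (_ | _)
      exacts [rfl, (hf _).1.symm]
    have ex : ∀ v : Fin S.numLeaves, ∃ p : X × X,
        (∀ hv : G.rot v = [], f (.inr ⟨v, hv⟩) = p.1) ∧
        Threads (fun d => B (.inl d.1)) (fun d => A (.inl d.1)) p.1 (fan S v) p.2 ∧
        Threads (fun d => A (.inr d.1)) (fun d => B (.inr d.1)) p.1 (fan T v) p.2 := by
      intro v
      obtain ⟨x, hx, hx'⟩ : ∃ x, (∀ hv : G.rot v = [], f (.inr ⟨v, hv⟩) = x) ∧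
          ∀ hn : G.rot v ≠ [], f (.inl ((G.rot v).getLast hn)) = x := by
        by_cases hv : G.rot v = []
        · exact ⟨f (.inr ⟨v, hv⟩), fun _ => rfl, fun hn => absurd hv hn⟩
        · exact ⟨f (.inl ((G.rot v).getLast hv)), fun hn => absurd hn hv, fun _ => rfl⟩
      obtain ⟨z, hz⟩ := (threads_rot S T h (fun d => f (.inl (G.rotPerm⁻¹ d)))
        (fun d => f (.inl d)) v x).1 ((threads_rot_iff S T h _ _ v x).2
          ⟨fun d _ => by simp [hG], hx'⟩)
      simp only [hA, hA', hB] at hz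
      exact ⟨(x, z), hx, hz⟩
    choose p hp using ex
    let P : Labels X S.numLeaves := (labelsEquiv X _).symm (fun v => (p v).1, fun v => (p v).2)
    have hP : ∀ v : Fin S.numLeaves, P.1.1 v = (p v).1 ∧ P.1.2 v = (p v).2 :=
      fun v => labelsEquiv_symm_apply _ v
    have h₁ : HalfPlane S (fun c => B (.inl c)) (fun c => A (.inl c)) P.1.1 P.1.2 := by
      intro v hv
      have := (hp ⟨v, hv⟩).2.1
      rwa [← (hP ⟨v, hv⟩).1, ← (hP ⟨v, hv⟩).2] at this
    have h₂ : HalfPlane T (fun c => A (.inr c)) (fun c => B (.inr c)) P.1.1 P.1.2 := by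
      intro v hv
      have := (hp ⟨v, h ▸ hv⟩).2.2
      rwa [← (hP ⟨v, h ▸ hv⟩).1, ← (hP ⟨v, h ▸ hv⟩).2] at this
    simp only [hA, hA', hB]
    refine ⟨⟨P, h₁.compat, h₂.compat⟩, fun v => ?_, ?_⟩
    · rw [(hP v).1, (hP v).2]
      exact hp v
    · rintro ⟨Q, hQ₁, hQ₂⟩ hQ
      have hR : ∀ v : Fin S.numLeaves, Q.1.1 v = (p v).1 := by
        intro v
        by_cases hv : G.rot v = []
        · rw [← (hQ v).1 hv, ← (hp v).1 hv]
        · have k₁ := (threads_rot S T h (fun d => B d.1) (fun d => A d.1) v _).2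
            ⟨_, (hQ v).2⟩
          have k₂ := (threads_rot S T h (fun d => B d.1) (fun d => A d.1) v _).2
            ⟨_, (hp v).2⟩
          exact (k₁.getLast hv).symm.trans (k₂.getLast hv)
      have hL : ∀ v : Fin S.numLeaves, Q.1.2 v = (p v).2 := by
        intro v
        have := (hQ v).2.1
        simp only [hR v] at this
        exact this.right_unique (hp v).2.1
      refine Subtype.ext ((labelsEquiv X _).injective ?_)
      simp only [P, Equiv.apply_symm_apply]
      exact Prod.ext (funext hR) (funext hL)
  · rintro ⟨P, hS, hT⟩
    obtain ⟨B₁, A₁, h₁⟩ := hS.exists_halfPlane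
    obtain ⟨B₂, A₂, h₂⟩ := hT.exists_halfPlane
    let f : ((Caret S ⊕ Caret T) × Bool) ⊕ {v : Fin S.numLeaves // G.rot v = []} → X :=
      Sum.elim (fun d => Sum.elim A₁ B₂ d.1) fun v => P.1.1 v.1
    have hf : ∀ e b, f (.inl (G.rotPerm⁻¹ (e, b))) = Sum.elim B₁ A₂ e := by
      intro e b
      obtain ⟨v, hv, -⟩ := G.existsUnique (G.rotPerm⁻¹ (e, b))
      have := (threads_rot S T h (fun d => Sum.elim B₁ A₂ d.1) (fun d => Sum.elim A₁ B₂ d.1) v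
        (P.1.1 v)).2 ⟨_, h₁ v v.2, h₂ v (h ▸ v.2)⟩
      have := ((threads_rot_iff _ _ _ _ _ _ _).1 this).1 _ hv
      simp only [← hG, Equiv.Perm.coe_inv, Equiv.apply_symm_apply] at this
      exact this.symm
    refine ⟨⟨f, ?_⟩, fun v => ⟨fun _ => rfl, ?_, ?_⟩, ?_⟩
    · rw [link, medial_continues_iff]
      intro e
      exact ⟨rfl, by rw [hf, hf]⟩
    · simp only [hf]
      exact h₁ v v.2
    · simp only [hf]
      exact h₂ v (h ▸ v.2)
    · rintro ⟨g, hg⟩ hgP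
      rw [link, medial_continues_iff] at hg
      have hB : ∀ e b, g (.inl (G.rotPerm⁻¹ (e, b))) = g (.inl (G.rotPerm⁻¹ (e, false))) := by
        rintro e (_ | _)
        exacts [rfl, (hg e).2.symm]
      have hA : ∀ c b, g (.inl (.inl c, b)) = g (.inl (.inl c, false)) := by
        rintro c (_ | _)
        exacts [rfl, (hg _).1.symm]
      have hA' : ∀ c b, g (.inl (.inr c, b)) = g (.inl (.inr c, false)) := by
        rintro c (_ | _)
        exacts [rfl, (hg _).1.symm]
      have k₁ : HalfPlane S (fun c => g (.inl (G.rotPerm⁻¹ (.inl c, false))))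
          (fun c => g (.inl (.inl c, false))) P.1.1 P.1.2 := by
        intro v hv
        have := (hgP ⟨v, hv⟩).2.1
        simp only [hB, hA] at this
        exact this
      have k₂ : HalfPlane T (fun c => g (.inl (.inr c, false)))
          (fun c => g (.inl (G.rotPerm⁻¹ (.inr c, false)))) P.1.1 P.1.2 := by
        intro v hv
        have := (hgP ⟨v, h ▸ hv⟩).2.2
        simp only [hB, hA'] at this
        exact this
      have e₁ := (k₁.unique h₁).2
      have e₂ := (k₂.unique h₂).1
      refine Subtype.ext (funext ?_)
      rintro (⟨c | c, b⟩ | ⟨v, hv⟩)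
      · exact (hA _ b).trans (congrFun e₁ c)
      · exact (hA' _ b).trans (congrFun e₂ c)
      · exact (hgP v).1 hv

end

/-! ### Opposing carets -/

/-- The tree obtained by attaching a caret to the leaf `i`. -/
def addCaret : BinaryTree Unit → ℕ → BinaryTree Unit
  | nil, _ => node () nil nil
  | node u l r, i => if i < l.numLeaves then node u (addCaret l i) r
      else node u l (addCaret r (i - l.numLeaves))

theorem numLeaves_addCaret (T : BinaryTree Unit) (i : ℕ) :
    (addCaret T i).numLeaves = T.numLeaves + 1 := by
  induction T generalizing i with
  | nil => rfl
  | node u l r hl hr =>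
    simp only [addCaret]
    split_ifs
    · simp only [numLeaves, hl]; omega
    · simp only [numLeaves, hr]; omega

section

variable {X : Type*}

/-- The right labels on the axis after cancelling the caret with the leaves `i` and `i + 1`: the
right point of `i` is reached through the left point of `i + 1`. -/
def contractR (i : ℕ) (R L : ℕ → X) (j : ℕ) : X :=
  if j < i then R j else if j = i then L (i + 1) else R (j + 1)

/-- The left labels on the axis after cancelling the caret with the leaves `i` and `i + 1`. -/
def contractL (i : ℕ) (L : ℕ → X) (j : ℕ) : X :=
  if j ≤ i then L j else L (j + 1)

theorem compat_addCaret (T : BinaryTree Unit) {i : ℕ} (hi : i < T.numLeaves) (R L : ℕ → X) :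
    Compat (addCaret T i) R L ↔
      R i = R (i + 1) ∧ Compat T (contractR i R L) (contractL i L) := by
  induction T generalizing i R L with
  | nil =>
    simp only [numLeaves, Nat.lt_one_iff] at hi
    subst hi
    simp only [addCaret, Compat, numLeaves, Function.update_self, contractR, contractL]
    simp
    grind
  | node u l r hl hr =>
    have h₁ := l.numLeaves_pos
    have h₂ := r.numLeaves_pos
    simp only [numLeaves] at hi
    simp only [addCaret]
    split_ifs with h
    · simp only [Compat, numLeaves_addCaret, hl h]
      have e : contractL i L l.numLeaves = L (l.numLeaves + 1) := by
        simp [contractL, h]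
      have e0 : contractL i L 0 = L 0 := by simp [contractL]
      rw [e, e0]
      constructor
      · rintro ⟨h0, y, ⟨hi, hl'⟩, hr'⟩
        refine ⟨hi, h0, y, (compat_congr l ?_ ?_).1 hl', (compat_congr r ?_ ?_).1 hr'⟩ <;>
        intro v hv <;> simp only [contractR, contractL, Function.update_apply] <;> grind
      · rintro ⟨hi, h0, y, hl', hr'⟩
        refine ⟨h0, y, ⟨hi, (compat_congr l ?_ ?_).1 hl'⟩, (compat_congr r ?_ ?_).1 hr'⟩ <;>
        intro v hv <;> simp only [contractR, contractL, Function.update_apply] <;> grind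
    · obtain ⟨j, rfl⟩ := Nat.exists_eq_add_of_le (not_lt.1 h)
      have hj : j < r.numLeaves := by omega
      simp only [Nat.add_sub_cancel_left, Compat, hr hj]
      have e : contractL (l.numLeaves + j) L l.numLeaves = L l.numLeaves := by
        simp [contractL]
      have e0 : contractL (l.numLeaves + j) L 0 = L 0 := by simp [contractL]
      rw [e, e0]
      constructor
      · rintro ⟨h0, y, hl', hi, hr'⟩
        refine ⟨hi, h0, y, (compat_congr l ?_ ?_).1 hl', (compat_congr r ?_ ?_).1 hr'⟩ <;>
        intro v hv <;> simp only [contractR, contractL, Function.update_apply] <;> grind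
      · rintro ⟨hi, h0, y, hl', hr'⟩
        refine ⟨h0, y, (compat_congr l ?_ ?_).1 hl', hi, (compat_congr r ?_ ?_).1 hr'⟩ <;>
        intro v hv <;> simp only [contractR, contractL, Function.update_apply] <;> grind

end

/-- A pair of opposing carets with the leaves `i` and `i + 1` adds one component, a circle through
the right points of `i` and `i + 1`, whose label is arbitrary. -/
def statesAddCaret (X : Type) [Inhabited X] (S T : BinaryTree Unit)
    (h : S.numLeaves = T.numLeaves) {i : ℕ} (hi : i < S.numLeaves) :
    States X (addCaret S i) (addCaret T i) ≃ X × States X S T where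
  toFun P := (P.1.1.1 i, ⟨⟨(contractR i P.1.1.1 P.1.1.2, contractL i P.1.1.2), by
    intro j hj
    have h₁ := P.1.2 (j + 1) (by rw [numLeaves_addCaret]; omega)
    simp [contractR, contractL, h₁, show ¬ j < i by omega, show ¬ j = i by omega,
      show ¬ j ≤ i by omega]⟩,
    ((compat_addCaret S hi _ _).1 P.2.1).2, ((compat_addCaret T (h ▸ hi) _ _).1 P.2.2).2⟩)
  invFun Q :=
    let R : ℕ → X := fun j => if j < i then Q.2.1.1.1 j else if j ≤ i + 1 then Q.1
      else Q.2.1.1.1 (j - 1)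
    let L : ℕ → X := fun j => if j ≤ i then Q.2.1.1.2 j else if j = i + 1 then Q.2.1.1.1 i
      else Q.2.1.1.2 (j - 1)
    have hR : contractR i R L = Q.2.1.1.1 := by
      funext j; simp only [contractR, R, L]; grind
    have hL : contractL i L = Q.2.1.1.2 := by
      funext j; simp only [contractL, L]; grind
    have hi' : R i = R (i + 1) := by simp [R]
    ⟨⟨(R, L), by
      intro j hj
      rw [numLeaves_addCaret] at hj
      have := Q.2.1.2 (j - 1) (by omega)
      simp [R, L, this, show ¬ j < i by omega, show ¬ j = i + 1 by omega,
        show ¬ j ≤ i by omega, show ¬ j ≤ i + 1 by omega]⟩,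
      (compat_addCaret S hi _ _).2 ⟨hi', by rw [hR, hL]; exact Q.2.2.1⟩,
      (compat_addCaret T (h ▸ hi) _ _).2 ⟨hi', by rw [hR, hL]; exact Q.2.2.2⟩⟩
  left_inv P := by
    have hi' := ((compat_addCaret S hi _ _).1 P.2.1).1
    refine Subtype.ext (Subtype.ext (Prod.ext (funext fun j => ?_) (funext fun j => ?_)))
    · simp only [contractR]; grind
    · simp only [contractR, contractL]; grind
  right_inv Q := by
    refine Prod.ext ?_ (Subtype.ext (Subtype.ext (Prod.ext (funext fun j => ?_)
      (funext fun j => ?_))))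
    · simp
    · simp only [contractR]; grind
    · simp only [contractL]; grind

theorem numComponents_addCaret (S T : BinaryTree Unit) (h : S.numLeaves = T.numLeaves) {i : ℕ}
    (hi : i < S.numLeaves) (h' : (addCaret S i).numLeaves = (addCaret T i).numLeaves) :
    (link (addCaret S i) (addCaret T i) h').numComponents = (link S T h).numComponents + 1 := by
  -- two labels suffice to read off the number of components
  have := Nat.card_congr (statesAddCaret Bool S T h hi)
  rw [Nat.card_prod, card_states _ _ h', card_states _ _ h] at this
  simp only [Nat.card_eq_fintype_card, Fintype.card_bool] at this
  rw [← pow_succ'] at this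
  exact Nat.pow_right_injective le_rfl this

/-- Adding a caret at a leaf is the first step of grafting a tree with a caret there. -/
theorem graft_addCaret (T : BinaryTree Unit) {i : ℕ} (hi : i < T.numLeaves)
    (s : ℕ → BinaryTree Unit) :
    graft (addCaret T i) s = graft T fun j =>
      if j < i then s j else if j = i then node () (s i) (s (i + 1)) else s (j + 1) := by
  induction T generalizing i s with
  | nil =>
    simp only [numLeaves, Nat.lt_one_iff] at hi
    subst hi
    rfl
  | node u l r hl hr =>
    simp only [numLeaves] at hi
    simp only [addCaret]
    split_ifs with h
    · simp only [graft, hl h, numLeaves_addCaret]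
      congr 1
      refine graft_congr _ _ _ fun j hj => ?_
      rw [if_neg (by omega), if_neg (by omega)]
      congr 1; omega
    · obtain ⟨j, rfl⟩ := Nat.exists_eq_add_of_le (not_lt.1 h)
      have hj : j < r.numLeaves := by omega
      simp only [graft, Nat.add_sub_cancel_left, hr hj]
      congr 1
      · refine graft_congr _ _ _ fun v hv => ?_
        rw [if_pos (by omega)]
      · refine graft_congr _ _ _ fun v hv => ?_
        simp [add_assoc]

theorem numLeaves_le_graft (T : BinaryTree Unit) (s : ℕ → BinaryTree Unit) :
    T.numLeaves ≤ (graft T s).numLeaves := by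
  rw [numLeaves_graft]
  calc T.numLeaves = ∑ i ∈ Finset.range T.numLeaves, 1 := by simp
    _ ≤ _ := Finset.sum_le_sum fun i _ => (s i).numLeaves_pos

theorem numComponents_congr {S T S' T' : BinaryTree Unit} (hS : S = S') (hT : T = T')
    (h : S.numLeaves = T.numLeaves) (h' : S'.numLeaves = T'.numLeaves) :
    (link S T h).numComponents = (link S' T' h').numComponents := by
  subst hS hT
  rfl

/-- Grafting the same trees onto `S` and `T` adds pairs of opposing carets, one after the other. -/
theorem numComponents_graft (S T : BinaryTree Unit) (h : S.numLeaves = T.numLeaves)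
    (s : ℕ → BinaryTree Unit) (h' : (graft S s).numLeaves = (graft T s).numLeaves) :
    (link (graft S s) (graft T s) h').numComponents + S.numLeaves =
      (link S T h).numComponents + (graft S s).numLeaves := by
  obtain ⟨N, hN⟩ : ∃ N, (graft S s).numLeaves - S.numLeaves = N := ⟨_, rfl⟩
  induction N using Nat.strong_induction_on generalizing S T s with
  | _ N ih =>
  by_cases hs : ∀ i < S.numLeaves, s i = nil
  · have e₁ : graft S s = S := (graft_congr S _ _ hs).trans (graft_nil S)
    have e₂ : graft T s = T :=
      (graft_congr T _ _ fun i hi => hs i (h ▸ hi)).trans (graft_nil T)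
    rw [numComponents_congr e₁ e₂ h' h, e₁]
  · push Not at hs
    obtain ⟨i, hi, hsi⟩ := hs
    obtain ⟨l, r, hlr⟩ : ∃ l r, s i = node () l r := by
      cases hc : s i with
      | nil => exact absurd hc hsi
      | node u l r => exact ⟨l, r, rfl⟩
    let s' : ℕ → BinaryTree Unit := fun j =>
      if j < i then s j else if j = i then l else if j = i + 1 then r else s (j - 1)
    have e : s = fun j => if j < i then s' j else if j = i then node () (s' i) (s' (i + 1))
        else s' (j + 1) := by
      funext j
      simp only [s']
      grind
    have e₁ : graft S s = graft (addCaret S i) s' := by rw [graft_addCaret S hi, ← e]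
    have e₂ : graft T s = graft (addCaret T i) s' := by rw [graft_addCaret T (h ▸ hi), ← e]
    have hle := numLeaves_le_graft (addCaret S i) s'
    have hc : (addCaret S i).numLeaves = (addCaret T i).numLeaves := by
      rw [numLeaves_addCaret, numLeaves_addCaret, h]
    rw [← e₁, numLeaves_addCaret] at hle
    have := ih ((graft S s).numLeaves - (S.numLeaves + 1)) (by omega) (addCaret S i)
      (addCaret T i) hc s' (by rw [← e₁, ← e₂, h']) (by rw [numLeaves_addCaret, e₁])
    rw [numComponents_congr e₁.symm e₂.symm _ h',
      numComponents_addCaret S T h hi hc] at this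
    have e₃ := congrArg numLeaves e₁
    have e₄ := numLeaves_addCaret S i
    omega

theorem eq_of_leafOf_of_tailOf {A B : BinaryTree Unit} (h : ∀ x, leafOf A x = leafOf B x)
    (h' : ∀ x, tailOf A x = tailOf B x) : A = B := by
  induction A generalizing B with
  | nil =>
    cases B with
    | nil => rfl
    | node u l r =>
      have h₁ := h (fun _ => true)
      have := l.numLeaves_pos
      rw [leafOf_nil, leafOf_node, if_pos rfl] at h₁
      omega
  | node u l r hl hr =>
    cases B with
    | nil =>
      have h₁ := h (fun _ => true)
      have := l.numLeaves_pos
      rw [leafOf_nil, leafOf_node, if_pos rfl] at h₁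
      omega
    | node u' l' r' =>
      have hf := fun y => h (headTail.symm (false, y))
      have ht := fun y => h (headTail.symm (true, y))
      have hf' := fun y => h' (headTail.symm (false, y))
      have ht' := fun y => h' (headTail.symm (true, y))
      simp only [leafOf_node, tailOf_node] at hf ht hf' ht'
      change ∀ y, leafOf l y = leafOf l' y at hf
      change ∀ y, tailOf l y = tailOf l' y at hf'
      change ∀ y, l.numLeaves + leafOf r y = l'.numLeaves + leafOf r' y at ht
      change ∀ y, tailOf r y = tailOf r' y at ht'
      obtain rfl := hl hf hf'
      obtain rfl := hr (fun y => Nat.add_left_cancel (ht y)) ht'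
      rfl

theorem eq_of_ofTrees_eq {A B B' : BinaryTree Unit} (h : A.numLeaves = B.numLeaves)
    (h' : A.numLeaves = B'.numLeaves) (e : ofTrees A B h = ofTrees A B' h') : B = B' := by
  refine eq_of_leafOf_of_tailOf (fun x => ?_) fun x => ?_
  · rw [← leafOf_ofTrees A B h, e, leafOf_ofTrees]
  · rw [← tailOf_ofTrees A B h, e, tailOf_ofTrees]

theorem numComponents_add_of_ofTrees_eq {S T S' T' : BinaryTree Unit}
    (h : S.numLeaves = T.numLeaves) (h' : S'.numLeaves = T'.numLeaves)
    (e : ofTrees S T h = ofTrees S' T' h') :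
    (link S T h).numComponents + S'.numLeaves = (link S' T' h').numComponents + S.numLeaves := by
  obtain ⟨s, t, hst⟩ := exists_graft_eq S S'
  have k : (graft S s).numLeaves = (graft T s).numLeaves := by
    rw [numLeaves_graft, numLeaves_graft, h]
  have k' : (graft S' t).numLeaves = (graft T' t).numLeaves := by
    rw [numLeaves_graft, numLeaves_graft, h']
  have hT : graft T s = graft T' t := by
    refine eq_of_ofTrees_eq k (hst ▸ k') ?_
    rw [ofTrees_graft S T h, e, ← ofTrees_graft S' T' h' t]
    simp only [hst]
  have h₁ := numComponents_graft S T h s k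
  have h₂ := numComponents_graft S' T' h' t k'
  rw [numComponents_congr hst hT k k', hst] at h₁
  omega

theorem linkExponent_element (S T : BinaryTree Unit) (h : S.numLeaves = T.numLeaves) :
    linkExponent (element S T h) = ((link S T h).numComponents : ℤ) - (S.numLeaves : ℤ) := by
  have := numComponents_add_of_ofTrees_eq h _
    (element S T h).2.choose_spec.choose_spec.choose_spec
  rw [linkExponent]
  omega

/-! ### The permutation of a tree -/

/-- The exponent `c` is the number of cycles of `τ`, fixed points included. The induction takes the
point `0` out of its cycle: the number of cycles drops by one if `0` is a fixed point, and is
unchanged otherwise. -/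
theorem exists_card_invariant (X : Type) [Finite X] {n : ℕ} (τ : Equiv.Perm (Fin n)) :
    ∃ c, Nat.card {q : Fin n → X // ∀ v, q (τ v) = q v} = Nat.card X ^ c ∧
      (Equiv.Perm.sign τ : ℤ) = (-1) ^ (n + c) := by
  induction n with
  | zero => exact ⟨0, by simp, by simp [Subsingleton.elim τ 1]⟩
  | succ n ih =>
    obtain ⟨⟨z, e⟩, rfl⟩ := Equiv.Perm.decomposeFin.symm.surjective τ
    obtain ⟨c, hc, hs⟩ := ih e
    have key : ∀ q : Fin (n + 1) → X, (∀ v, q (Equiv.Perm.decomposeFin.symm (z, e) v) = q v) ↔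
        q z = q 0 ∧ ∀ v, q (e v).succ = q v.succ := by
      intro q
      rw [Fin.forall_fin_succ, Equiv.Perm.decomposeFin_symm_apply_zero]
      refine and_congr_right fun h0 => forall_congr' fun v => ?_
      rw [Equiv.Perm.decomposeFin_symm_apply_succ, Equiv.swap_apply_def]
      split_ifs with h₁ h₂
      · rw [h₁, h0]
      · rw [h₂, h0]
      · rfl
    simp only [key, Equiv.Perm.decomposeFin.symm_sign]
    induction z using Fin.cases with
    | zero =>
      refine ⟨c + 1, ?_, ?_⟩
      · rw [pow_succ', ← hc, ← Nat.card_prod]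
        exact Nat.card_congr
          { toFun := fun q => (q.1 0, ⟨fun v => q.1 v.succ, q.2.2⟩)
            invFun := fun q => ⟨Fin.cons q.1 q.2.1, rfl, q.2.2⟩
            left_inv := fun q => Subtype.ext (Fin.cons_self_tail q.1)
            right_inv := fun q => rfl }
      · simp only [if_true, one_mul, hs]
        ring
    | succ z =>
      refine ⟨c, ?_, ?_⟩
      · rw [← hc]
        exact Nat.card_congr
          { toFun := fun q => ⟨fun v => q.1 v.succ, q.2.2⟩
            invFun := fun q => ⟨Fin.cons (q.1 z) q.1, rfl, q.2⟩
            left_inv := fun q => Subtype.ext (by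
              refine funext fun v => ?_
              induction v using Fin.cases with
              | zero => exact q.2.1
              | succ v => rfl)
            right_inv := fun q => rfl }
      · simp [hs]
        ring

/-- The disjoint union of `σ` and `ρ⁻¹`, with the cycle through `a` joined to the cycle through `b`.
It is the permutation of a tree (see `exists_perm`) in terms of those of its two subtrees, where `a`
and `b` are their first leaves. -/
def joinPerm {α β : Type} [DecidableEq α] [DecidableEq β] (σ : Equiv.Perm α)
    (ρ : Equiv.Perm β) (a : α) (b : β) : Equiv.Perm (α ⊕ β) :=
  Equiv.Perm.sumCongr σ ρ⁻¹ * Equiv.swap (.inl (σ⁻¹ a)) (.inr b)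

theorem forall_joinPerm_iff {α β X : Type} [DecidableEq α] [DecidableEq β] (σ : Equiv.Perm α)
    (ρ : Equiv.Perm β) (a : α) (b : β) (p q : α → X) (p' q' : β → X) :
    (∀ w, Sum.elim q p' (joinPerm σ ρ a b w) = Sum.elim p q' w) ↔
      q a = q' b ∧ ∃ y, (∀ v, Function.update q a y (σ v) = p v) ∧
        ∀ v, Function.update q' b y (ρ v) = p' v := by
  have h₁ : ∀ v, joinPerm σ ρ a b (.inl v) = if σ v = a then .inr (ρ⁻¹ b) else .inl (σ v) := by
    intro v
    simp only [joinPerm, Equiv.Perm.mul_apply, Equiv.swap_apply_def]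
    by_cases h : σ v = a
    · simp [← h]
    · have : v ≠ σ⁻¹ a := by
        rintro rfl
        simp at h
      rw [if_neg fun e => this (Sum.inl_injective e), if_neg (by simp), if_neg h]
      rfl
  have h₂ : ∀ v, joinPerm σ ρ a b (.inr v) = if v = b then .inl a else .inr (ρ⁻¹ v) := by
    intro v
    simp only [joinPerm, Equiv.Perm.mul_apply, Equiv.swap_apply_def]
    by_cases h : v = b <;> simp [h]
  simp only [Sum.forall, h₁, h₂]
  constructor
  · rintro ⟨hl, hr⟩
    refine ⟨by simpa using hr b, p' (ρ⁻¹ b), fun v => ?_, fun v => ?_⟩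
    · have := hl v
      rw [Function.update_apply]
      split_ifs with h
      · simpa [h] using this
      · simpa [h] using this
    · have := hr (ρ v)
      rw [Function.update_apply]
      split_ifs with h
      · simp [← h]
      · simpa [h] using this.symm
  · rintro ⟨h0, y, hl, hr⟩
    refine ⟨fun v => ?_, fun v => ?_⟩
    · have h := hl v
      have h' := hr (ρ⁻¹ b)
      rw [Function.update_apply] at h h'
      split_ifs with hv
      · simp_all
      · simpa [hv] using h
    · have h' := hr (ρ⁻¹ v)
      rw [Function.update_apply] at h'
      split_ifs with hv
      · simpa [hv] using h0
      · simpa [hv] using h'.symm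

/-- Orient the circle around `v` counterclockwise if the colour of `v` is `false` and clockwise
otherwise. This is the label of the point where the circle enters the upper half plane. -/
def source {X : Type} (T : BinaryTree Unit) (R L : ℕ → X) (v : ℕ) : X :=
  if leafColor T v then L v else R v

/-- The label of the point where the circle around `v`, oriented as in `source`, leaves the upper
half plane. -/
def sink {X : Type} (T : BinaryTree Unit) (R L : ℕ → X) (v : ℕ) : X :=
  if leafColor T v then R v else L v

theorem sink_update {X : Type} (T : BinaryTree Unit) (R L : ℕ → X) (y : X) :
    sink T R (Function.update L 0 y) = Function.update (sink T R L) 0 y := by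
  funext v
  rcases eq_or_ne v 0 with rfl | h
  · simp [sink, leafColor_zero]
  · simp [sink, h]

theorem source_update {X : Type} (T : BinaryTree Unit) (R L : ℕ → X) (y : X) :
    source T R (Function.update L 0 y) = source T R L := by
  funext v
  rcases eq_or_ne v 0 with rfl | h
  · simp [source, leafColor_zero]
  · simp [source, h]

/-- Vertices joined by an edge have different colours, so the orientations of the circles around
them fit together at the crossings: each strand of the tangle of `T` leads from a source to a sink.
The resulting permutation is odd or even according to the number of leaves alone, since each caret
contributes one transposition. -/
theorem exists_perm (T : BinaryTree Unit) {n : ℕ} (hn : T.numLeaves = n) :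
    ∃ σ : Equiv.Perm (Fin n), (Equiv.Perm.sign σ : ℤ) = (-1) ^ (n + 1) ∧
      ∀ (X : Type) (R L : ℕ → X), Compat T R L ↔
        ∀ v : Fin n, sink T R L (σ v) = source T R L v := by
  induction T generalizing n with
  | nil =>
    obtain rfl : 1 = n := hn
    refine ⟨1, by simp, fun X R L => ?_⟩
    simp [Compat, sink, source, leafColor, eq_comm]
  | node u l r hl hr =>
    obtain ⟨σ, hσ, hσ'⟩ := hl rfl
    obtain ⟨ρ, hρ, hρ'⟩ := hr rfl
    have hlp := l.numLeaves_pos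
    have hrp := r.numLeaves_pos
    simp only [numLeaves] at hn
    let e : Fin l.numLeaves ⊕ Fin r.numLeaves ≃ Fin n := finSumFinEquiv.trans (finCongr hn)
    have he : ∀ v, (e (.inl v) : ℕ) = v := fun v => rfl
    have he' : ∀ v, (e (.inr v) : ℕ) = l.numLeaves + v := fun v => rfl
    refine ⟨e.permCongr (joinPerm σ ρ ⟨0, hlp⟩ ⟨0, hrp⟩), ?_, fun X R L => ?_⟩
    · rw [Equiv.Perm.sign_permCongr, joinPerm, Equiv.Perm.sign_mul, Equiv.Perm.sign_swap (by simp)]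
      rw [show Equiv.Perm.sign (Equiv.Perm.sumCongr σ ρ⁻¹) =
        Equiv.Perm.sign σ * Equiv.Perm.sign ρ by
          rw [Equiv.Perm.sign_sumCongr, Equiv.Perm.sign_inv]]
      push_cast
      rw [hσ, hρ, ← hn]
      ring
    · have hup : ∀ {n : ℕ} (hn : 0 < n) (f : ℕ → X) (y : X) (v : Fin n),
          Function.update f 0 y v = Function.update (fun w : Fin n => f w) ⟨0, hn⟩ y v := by
        intro n hn f y v
        simp [Function.update_apply, Fin.ext_iff]
      simp only [Compat, hσ', hρ', sink_update, source_update, hup hlp, hup hrp]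
      have h0 : L 0 = sink l R L (⟨0, hlp⟩ : Fin l.numLeaves) := by simp [sink, leafColor_zero]
      have hm : L l.numLeaves = sink r (fun i => R (l.numLeaves + i))
          (fun i => L (l.numLeaves + i)) (⟨0, hrp⟩ : Fin r.numLeaves) := by
        simp [sink, leafColor_zero]
      rw [h0, hm]
      rw [← forall_joinPerm_iff σ ρ ⟨0, hlp⟩ ⟨0, hrp⟩
        (fun v => source l R L v) (fun v => sink l R L v)
        (fun v => source r (fun i => R (l.numLeaves + i)) (fun i => L (l.numLeaves + i)) v)
        (fun v => sink r (fun i => R (l.numLeaves + i)) (fun i => L (l.numLeaves + i)) v)]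
      have e₁ : ∀ w : Fin l.numLeaves ⊕ Fin r.numLeaves,
          sink (node u l r) R L (e w) =
          Sum.elim (fun v : Fin l.numLeaves => sink l R L v) (fun v : Fin r.numLeaves =>
            source r (fun i => R (l.numLeaves + i)) (fun i => L (l.numLeaves + i)) v) w := by
        rintro (v | v)
        · simp [sink, leafColor, he]
        · simp only [sink, source, leafColor, he', Sum.elim_inr]
          simp
          grind
      have e₂ : ∀ w : Fin l.numLeaves ⊕ Fin r.numLeaves,
          source (node u l r) R L (e w) =
          Sum.elim (fun v : Fin l.numLeaves => source l R L v) (fun v : Fin r.numLeaves =>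
            sink r (fun i => R (l.numLeaves + i)) (fun i => L (l.numLeaves + i)) v) w := by
        rintro (v | v)
        · simp [source, leafColor, he]
        · simp only [sink, source, leafColor, he', Sum.elim_inr]
          simp
          grind
      simp only [← e₁, ← e₂]
      constructor
      · intro h v
        obtain ⟨w, rfl⟩ := e.surjective v
        rw [Equiv.permCongr_apply, Equiv.symm_apply_apply]
        exact h w
      · intro h w
        have := h (e w)
        rwa [Equiv.permCongr_apply, Equiv.symm_apply_apply] at this

/-- If `Γ(S, T)` is bipartite, the components of the link are the cycles of the product of one
permutation and the inverse of the other, which have the same sign. -/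
theorem even_numComponents_add (S T : BinaryTree Unit) (h : S.numLeaves = T.numLeaves)
    (hc : ∀ v < S.numLeaves, leafColor S v = leafColor T v) :
    Even ((link S T h).numComponents + S.numLeaves) := by
  obtain ⟨σ, hσ, hσ'⟩ := exists_perm S rfl
  obtain ⟨ρ, hρ, hρ'⟩ := exists_perm T h.symm
  obtain ⟨c, hc₁, hc₂⟩ := exists_card_invariant Bool (σ * ρ⁻¹)
  have e₁ : ∀ (R L : ℕ → Bool) (v : Fin S.numLeaves), sink T R L v = sink S R L v := by
    intro R L v
    rw [sink, sink, hc v v.2]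
  have e₂ : ∀ (R L : ℕ → Bool) (v : Fin S.numLeaves), source T R L v = source S R L v := by
    intro R L v
    rw [source, source, hc v v.2]
  replace hσ' := hσ' Bool
  replace hρ' := hρ' Bool
  simp only [e₁, e₂] at hρ'
  have key : Nat.card (States Bool S T) =
      Nat.card {q : Fin S.numLeaves → Bool // ∀ v, q ((σ * ρ⁻¹) v) = q v} := by
    refine card_eq_of_existsUnique (fun P q => ∀ v, q.1 v = sink S P.1.1.1 P.1.1.2 v) ?_ ?_
    · rintro ⟨P, hS, hT⟩
      rw [hσ'] at hS
      rw [hρ'] at hT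
      refine ⟨⟨fun v => sink S P.1.1 P.1.2 v, fun v => ?_⟩, fun v => rfl,
        fun q hq => Subtype.ext (funext hq)⟩
      have := hT (ρ⁻¹ v)
      simp only [Equiv.Perm.mul_apply, hS, ← this]
      simp
    · rintro ⟨q, hq⟩
      have hq' : ∀ v, q (σ v) = q (ρ v) := fun v => by simpa using hq (ρ v)
      let P : Labels Bool S.numLeaves := (labelsEquiv Bool _).symm
        (fun v => if leafColor S v then q v else q (σ v),
          fun v => if leafColor S v then q (σ v) else q v)
      have hP : ∀ v : Fin S.numLeaves, P.1.1 v = (if leafColor S v then q v else q (σ v)) ∧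
          P.1.2 v = if leafColor S v then q (σ v) else q v :=
        fun v => labelsEquiv_symm_apply _ v
      have k₁ : ∀ v : Fin S.numLeaves, sink S P.1.1 P.1.2 v = q v := by
        intro v
        rw [sink, (hP v).1, (hP v).2]
        grind
      have k₂ : ∀ v : Fin S.numLeaves, source S P.1.1 P.1.2 v = q (σ v) := by
        intro v
        rw [source, (hP v).1, (hP v).2]
        grind
      refine ⟨⟨P, ?_, ?_⟩, fun v => (k₁ v).symm, ?_⟩
      · rw [hσ']
        intro v
        rw [k₁, k₂]
      · rw [hρ']
        intro v
        rw [k₁, k₂, hq']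
      · rintro ⟨Q, hQ, _⟩ hQ'
        rw [hσ'] at hQ
        replace hQ' : ∀ v : Fin S.numLeaves, q v = sink S Q.1.1 Q.1.2 v := hQ'
        have k₃ : ∀ v : Fin S.numLeaves, source S Q.1.1 Q.1.2 v = q (σ v) := fun v => by
          rw [← hQ, hQ']
        -- source and sink labels together determine the labels `R` and `L`
        refine Subtype.ext ((labelsEquiv Bool _).injective (Prod.ext (funext fun v => ?_)
          (funext fun v => ?_)))
        · change Q.1.1 v = P.1.1 v
          have h₁ := hQ' v
          have h₂ := k₃ v
          rw [(hP v).1]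
          simp only [sink, source] at h₁ h₂
          grind
        · change Q.1.2 v = P.1.2 v
          have h₁ := hQ' v
          have h₂ := k₃ v
          rw [(hP v).2]
          simp only [sink, source] at h₁ h₂
          grind
  rw [card_states S T h, hc₁] at key
  simp only [Nat.card_eq_fintype_card, Fintype.card_bool] at key
  rw [Nat.pow_right_injective le_rfl key]
  rw [Equiv.Perm.sign_mul, Equiv.Perm.sign_inv] at hc₂
  push_cast at hc₂
  rw [hσ, hρ, ← mul_pow] at hc₂
  simp only [mul_neg, mul_one, neg_neg, one_pow] at hc₂
  rw [add_comm]
  exact (neg_one_pow_eq_one_iff_even (by norm_num)).1 hc₂.symm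

/-! ### Positivity -/

theorem even_linkExponent {g : ThompsonF} (hg : g ∈ JonesF) : Even (linkExponent g) := by
  obtain ⟨S, T, h, rfl, hb⟩ := hg
  rw [isBipartite_gamma_iff] at hb
  have := even_numComponents_add S T h hb
  rw [linkExponent_element]
  rw [Int.even_sub, Int.even_coe_nat, Int.even_coe_nat]
  exact Nat.even_add.1 this

theorem exists_graft_graft_eq (T : BinaryTree Unit) (s t : ℕ → BinaryTree Unit) :
    ∃ s', graft (graft T s) t = graft T s' := by
  induction T generalizing s t with
  | nil => exact ⟨fun _ => graft (s 0) t, rfl⟩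
  | node u l r hl hr =>
    obtain ⟨s₁, h₁⟩ := hl s t
    obtain ⟨s₂, h₂⟩ := hr (fun i => s (l.numLeaves + i))
      (fun i => t ((graft l s).numLeaves + i))
    refine ⟨fun i => if i < l.numLeaves then s₁ i else s₂ (i - l.numLeaves), ?_⟩
    simp only [graft]
    rw [h₁, h₂]
    congr 1
    · exact graft_congr l _ _ fun i hi => by simp [hi]
    · exact graft_congr r _ _ fun i hi => by simp

theorem exists_common_graft (r : ℕ) (B : Fin r → BinaryTree Unit) :
    ∃ C, ∀ i, ∃ s, graft (B i) s = C := by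
  induction r with
  | zero => exact ⟨nil, fun i => i.elim0⟩
  | succ r ih =>
    obtain ⟨C, hC⟩ := ih fun i => B i.succ
    obtain ⟨s, t, hst⟩ := exists_graft_eq (B 0) C
    refine ⟨graft C t, fun i => ?_⟩
    induction i using Fin.cases with
    | zero => exact ⟨s, hst⟩
    | succ i =>
      obtain ⟨s', hs'⟩ := hC i
      obtain ⟨s'', hs''⟩ := exists_graft_graft_eq (B i.succ) s' t
      exact ⟨s'', by rw [← hs'', hs']⟩

/-- Finitely many elements have representatives `g(A i, B)` with a common second tree. -/
theorem exists_common_denominator (r : ℕ) (g : Fin r → ThompsonF) :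
    ∃ (B : BinaryTree Unit) (A : Fin r → BinaryTree Unit)
      (hA : ∀ i, (A i).numLeaves = B.numLeaves), ∀ i, g i = element (A i) B (hA i) := by
  choose S T h e using fun i => (g i).2
  obtain ⟨C, hC⟩ := exists_common_graft r T
  choose s hs using hC
  have hA : ∀ i, (graft (S i) (s i)).numLeaves = C.numLeaves := by
    intro i
    rw [← hs i, numLeaves_graft, numLeaves_graft, h i]
  refine ⟨C, fun i => graft (S i) (s i), hA, fun i => Subtype.ext ?_⟩
  rw [e i, ← ofTrees_graft (S i) (T i) (h i) (s i)]
  simp only [element, hs]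

theorem card_states_of_eq (X : Type) [Inhabited X] (S T : BinaryTree Unit) {n : ℕ}
    (hS : S.numLeaves = n) (h : S.numLeaves = T.numLeaves) :
    Nat.card {P : Labels X n // Compat S P.1.1 P.1.2 ∧ Compat T P.1.1 P.1.2} =
      Nat.card X ^ (link S T h).numComponents := by
  subst hS
  exact card_states S T h

open scoped ComplexOrder in
/-- For positive `k` the matrix is, up to the factor `k ^ (-n)`, the Gram matrix of the indicator
vectors of the compatible labels of the trees `A i`, and bipartiteness plays no role. -/
theorem posSemidef_pow_linkExponent (k : ℕ) (hk : k ≠ 0) (r : ℕ) (g : Fin r → ThompsonF) :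
    (Matrix.of fun i j => (k : ℂ) ^ linkExponent (g i * (g j)⁻¹)).PosSemidef := by
  classical
  obtain ⟨m, rfl⟩ := Nat.exists_eq_succ_of_ne_zero hk
  obtain ⟨B, A, hA, hg⟩ := exists_common_denominator r g
  set n := B.numLeaves with hn
  let _ : Fintype (Labels (Fin (m + 1)) n) := Fintype.ofFinite _
  let V : Matrix (Fin r) (Labels (Fin (m + 1)) n) ℂ :=
    Matrix.of fun i P => if Compat (A i) P.1.1 P.1.2 then 1 else 0
  have key : (Matrix.of fun i j => ((m + 1 : ℕ) : ℂ) ^ linkExponent (g i * (g j)⁻¹)) =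
      (((m + 1 : ℕ) : ℂ) ^ n)⁻¹ • (V * V.conjTranspose) := by
    ext i j
    have hij : (A i).numLeaves = (A j).numLeaves := (hA i).trans (hA j).symm
    have e : g i * (g j)⁻¹ = element (A i) (A j) hij := by
      refine Subtype.ext ?_
      rw [hg i, hg j]
      change ofTrees (A i) B (hA i) * (ofTrees (A j) B (hA j))⁻¹ = ofTrees (A i) (A j) hij
      rw [ofTrees_inv, ofTrees_mul]
    have hc := card_states_of_eq (Fin (m + 1)) (A i) (A j) (hA i) hij
    rw [Nat.card_eq_fintype_card (α := Fin (m + 1)), Fintype.card_fin] at hc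
    rw [Matrix.of_apply, e, linkExponent_element]
    generalize (link (A i) (A j) hij).numComponents = c at hc ⊢
    rw [hA i, zpow_sub₀ (by exact_mod_cast hk),
      zpow_natCast, zpow_natCast, ← Nat.cast_pow, ← hc, Matrix.smul_apply, Matrix.mul_apply,
      smul_eq_mul, div_eq_inv_mul, Nat.card_eq_fintype_card, Fintype.card_subtype,
      Finset.card_filter]
    push_cast
    congr 1
    refine Finset.sum_congr rfl fun P _ => ?_
    simp only [V, Matrix.conjTranspose_apply, Matrix.of_apply]
    by_cases h₁ : Compat (A i) P.1.1 P.1.2 <;> by_cases h₂ : Compat (A j) P.1.1 P.1.2 <;>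
      simp [h₁, h₂]
  rw [key]
  refine (Matrix.posSemidef_self_mul_conjTranspose V).smul ?_
  rw [← Nat.cast_pow]
  exact inv_nonneg.2 (Nat.cast_nonneg _)

end JonesThompson

end

theorem theorem5p2 :
    (∀ (S T : BinaryTree Unit) (h : S.numLeaves = T.numLeaves),
      JonesThompson.linkExponent (JonesThompson.element S T h) =
        ((JonesThompson.link S T h).numComponents : ℤ) - (S.numLeaves : ℤ)) ∧
    ∀ k : ℤ, k ≠ 0 →
      JonesThompson.IsOfPositiveType fun g : JonesThompson.JonesF =>
        (k : ℂ) ^ JonesThompson.linkExponent (g : JonesThompson.ThompsonF) := by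
  refine ⟨JonesThompson.linkExponent_element, fun k hk r g => ?_⟩
  -- the exponents are even, so that `k` may be replaced by its absolute value
  have habs : ∀ x : JonesThompson.JonesF, (k : ℂ) ^ JonesThompson.linkExponent x =
      (k.natAbs : ℂ) ^ JonesThompson.linkExponent x := by
    intro x
    have he := JonesThompson.even_linkExponent x.2
    rcases Int.natAbs_eq k with h | h
    · rw [h]; simp
    · rw [h]; simp [he.neg_zpow]
  simp only [habs]
  exact JonesThompson.posSemidef_pow_linkExponent k.natAbs (Int.natAbs_ne_zero.2 hk) r
    fun i => (g i : JonesThompson.ThompsonF)
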